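/- **Setup.** Let $\widetilde G=\langle x_0,\dots,x_6\mid x_ix_{i+1}x_{i+3},\ i=0,\dots,6\rangle$ (indices modulo $7$) and let $G\le\widetilde G$ be the subgroup generated by $x_0,x_1,x_3$ (note $x_0x_1x_3=1$). For $a_j=(a_{j1},a_{j2},a_{j3})\in M(3,\mathbb F_2)^3$ let $M_0(a_1,a_2,\dots)$ be the infinite upper triangular block matrix, rows and columns indexed by $1,2,\dots$, with identity blocks on the main diagonal and with the blocks of its $j$-th upper diagonal given by $a_{j1},a_{j2},a_{j3}$, repeated periodically. Put $$A=\begin{pmatrix}0&0&0\\0&0&1\\0&1&1\end{pmatrix},\quad D_1=1,\quad D_2=\begin{pmatrix}0&0&1\\1&0&1\\0&1&0\end{pmatrix},\quad D_3=\begin{pmatrix}1&0&1\\1&1&1\\0&1&1\end{pmatrix}\in M(3,\mathbb F_2),$$ and let $D$ be the infinite block diagonal matrix with diagonal blocks $D_1,D_2,D_3$, repeated periodically; $D^7=1$. Then $$x_0\mapsto M_0\big((A,A,A),(A^3,A^3,A^3),(A^2,A^2,A^2),(A,A,0),(A^3,0,0),0,0,\dots\big),\qquad x_i\mapsto D^{-i}x_0D^{i}\quad(0\le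 i\le 6)$$ defines a representation of $\widetilde G$. Let $G^k\trianglelefteq G$ be the normal subgroup of the elements whose matrices have vanishing first $k$ upper diagonals, and let $G_k=G/G^k$, a finite $2$-group; write $x_0,x_1,x_3$ also for the images in $G_k$. Take one white and one black triangle for every element of $G_k$, each with sides labelled $0,1,3$, and glue, for every $h\in G_k$, the white triangle of $h$ to the black triangles of $hx_3$, $h$ and $hx_0^{-1}$ along the sides labelled $0$, $1$ and $3$ respectively, identifying equally labelled corners. (Thus the black triangle of $h$ fills in the triangle $h,\ hx_0,\ hx_0x_1$ of the Cayley graph of $G_k$ with respect to $\{x_0^{\pm1},x_1^{\pm1},x_3^{\pm1}\}$, with the white triangles at its vertices.) For $k\ge 2$ the result is a closed connected oriented surface $\mathcal S_k$, which is a hyperbolic surface if the triangles are compact equilateral hyperbolic triangles with angles $\pi/\mathrm{ord}_{G_k}(x_0)$; let $g(\mathcal S_k)$ be its genus. Let $T_k^*$ be the triangulation of $\mathcal S_k$ by these $2|G_k|$ triangles (it is the dual of the trivalent graph $T_k\subset\mathcal S_k$ which joins the centres of adjacent triangles), and let $E(T_k^*)$ be its set of edges. **Proposition.** The non-flatness ratio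 of the triangulations $T_k^*$ tends to one: $$\lim_{k\to\infty}\frac{6\,g(\mathcal S_k)}{|E(T_k^*)|}=1 .$$ -/

import Mathlib

namespace ExpanderSurface

/-! ### Infinite upper triangular Toeplitz matrices over `M(3, 𝔽₂)` -/

/-- `M(3, 𝔽₂)`. -/
abbrev M3 : Type := Matrix (Fin 3) (Fin 3) (ZMod 2)

/-- The ring of infinite upper triangular matrices `(f i j)_{i, j ∈ ℕ}` with entries in `M(3, 𝔽₂)`
(the incidence algebra of the ordered set `ℕ`; its product is the matrix product). -/
abbrev UT : Type := IncidenceAlgebra M3 ℕ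

/-- The upper triangular matrix with `3`-periodic diagonals: the entry at `(i, i + d)` is
`a d (i mod 3)`. With `a 0 = 1` this is the matrix written `M₀(a₁, a₂, …)`,
`a_d = (a d 0, a d 1, a d 2)`. -/
def toeplitz (a : ℕ → ZMod 3 → M3) : UT :=
  ⟨fun i j => if i ≤ j then a (j - i) (i : ZMod 3) else 0, fun _ _ h => if_neg h⟩

/-- The product of periodic coefficient sequences. -/
def conv (a b : ℕ → ZMod 3 → M3) : ℕ → ZMod 3 → M3 :=
  fun n r => ∑ j ∈ Finset.range (n + 1), a j r * b (n - j) (r + (j : ZMod 3))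

theorem toeplitz_mul (a b : ℕ → ZMod 3 → M3) :
    toeplitz a * toeplitz b = toeplitz (conv a b) := by
  ext1 i j hij
  obtain ⟨n, rfl⟩ := Nat.exists_eq_add_of_le hij
  have e : Finset.Icc i (i + n) = (Finset.range (n + 1)).image (fun d => i + d) := by
    ext x
    simp only [Finset.mem_Icc, Finset.mem_image, Finset.mem_range]
    constructor
    · rintro ⟨h1, h2⟩
      exact ⟨x - i, by omega, by omega⟩
    · rintro ⟨d, hd, rfl⟩
      omega
  rw [IncidenceAlgebra.mul_apply, e, Finset.sum_image (by intro x _ y _ h; simpa using h)]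
  simp only [toeplitz, conv, IncidenceAlgebra.coe_mk, if_pos hij, Nat.add_sub_cancel_left]
  refine Finset.sum_congr rfl fun d hd => ?_
  have hd' : d ≤ n := by simpa [Nat.lt_succ_iff] using hd
  rw [if_pos (by omega), if_pos (by omega)]
  have : i + n - (i + d) = n - d := by omega
  rw [this]
  push_cast
  rfl

/-- The coefficients of the identity matrix. -/
def oneCoef : ℕ → ZMod 3 → M3 := fun n _ => if n = 0 then 1 else 0

theorem toeplitz_one : toeplitz oneCoef = 1 := by
  ext1 i j hij
  simp only [toeplitz, oneCoef, IncidenceAlgebra.coe_mk, if_pos hij, IncidenceAlgebra.one_apply]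
  congr 1
  simp only [eq_iff_iff]
  omega

theorem conv_band {a b : ℕ → ZMod 3 → M3} {p q : ℕ} (ha : ∀ n, p < n → ∀ r, a n r = 0)
    (hb : ∀ n, q < n → ∀ r, b n r = 0) (n : ℕ) (hn : p + q < n) (r : ZMod 3) :
    conv a b n r = 0 := by
  refine Finset.sum_eq_zero fun j _ => ?_
  by_cases h : p < j
  · rw [ha j h, zero_mul]
  · rw [hb (n - j) (by omega), mul_zero]

/-- The common `3 × 3` block of the first upper diagonal of the matrix of `x₀`. -/
def A : M3 := !![0, 0, 0; 0, 0, 1; 0, 1, 1]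

/-- The diagonals of the (finite band) matrix of `x₀`. -/
def coef0 : ℕ → ZMod 3 → M3
  | 0, _ => 1
  | 1, _ => A
  | 2, _ => A ^ 3
  | 3, _ => A ^ 2
  | 4, r => if r = 2 then 0 else A
  | 5, r => if r = 0 then A ^ 3 else 0
  | _, _ => 0

/-- The diagonals of the inverse of the matrix of `x₀`. -/
def coef0Inv : ℕ → ZMod 3 → M3
  | 0, _ => 1
  | 1, _ => A
  | 2, _ => A
  | 3, _ => A
  | 4, r => if r = 2 then 0 else A
  | 5, r => if r = 0 then A else 0
  | _, _ => 0

/-- The three periodically repeated blocks of a block diagonal matrix of order `7`. -/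
def diagBlock (r : ZMod 3) : M3 :=
  if r = 0 then 1
  else if r = 1 then !![0, 0, 1; 1, 0, 1; 0, 1, 0]
  else !![1, 0, 1; 1, 1, 1; 0, 1, 1]

/-- The coefficients of the `m`-th power of the block diagonal matrix. -/
def diagCoef (m : ℕ) : ℕ → ZMod 3 → M3 := fun n r => if n = 0 then diagBlock r ^ m else 0

theorem toeplitz_diag_mul (m l : ℕ) :
    toeplitz (diagCoef m) * toeplitz (diagCoef l) = toeplitz (diagCoef (m + l)) := by
  rw [toeplitz_mul]
  congr 1
  funext n r
  unfold conv
  rw [Finset.sum_eq_single 0]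
  · by_cases h : n = 0 <;> simp [diagCoef, h, pow_add]
  · intro j _ hj
    simp [diagCoef, hj]
  · simp

theorem diagBlock_pow_seven : ∀ r, diagBlock r ^ 7 = 1 := by decide +kernel

theorem toeplitz_diag_seven : toeplitz (diagCoef 7) = 1 := by
  rw [← toeplitz_one]
  congr 1
  funext n r
  simp only [diagCoef, oneCoef, diagBlock_pow_seven]

theorem toeplitz_diag_one_pow (m : ℕ) : toeplitz (diagCoef 1) ^ m = toeplitz (diagCoef m) := by
  induction m with
  | zero =>
    rw [pow_zero, ← toeplitz_one]
    congr 1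
  | succ m ih => rw [pow_succ, ih, toeplitz_diag_mul]

theorem band_ext {a b : ℕ → ZMod 3 → M3} (N : ℕ) (ha : ∀ n, N < n → ∀ r, a n r = 0)
    (hb : ∀ n, N < n → ∀ r, b n r = 0) (h : ∀ n ∈ Finset.range (N + 1), ∀ r, a n r = b n r) :
    a = b := by
  funext n r
  by_cases hn : N < n
  · rw [ha n hn, hb n hn]
  · exact h n (Finset.mem_range.2 (by omega)) r

theorem coef0_band : ∀ n, 5 < n → ∀ r, coef0 n r = 0 := by
  intro n hn r
  obtain ⟨m, rfl⟩ := Nat.exists_eq_add_of_le hn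
  rw [Nat.add_comm]
  rfl

theorem coef0Inv_band : ∀ n, 5 < n → ∀ r, coef0Inv n r = 0 := by
  intro n hn r
  obtain ⟨m, rfl⟩ := Nat.exists_eq_add_of_le hn
  rw [Nat.add_comm]
  rfl

theorem oneCoef_band : ∀ n, 10 < n → ∀ r, oneCoef n r = 0 := by
  intro n hn r
  exact if_neg (by omega)

theorem coef0_mul_inv : conv coef0 coef0Inv = oneCoef :=
  band_ext 10 (fun n hn r => conv_band coef0_band coef0Inv_band n hn r) oneCoef_band
    (by decide +kernel)

theorem coef0_inv_mul : conv coef0Inv coef0 = oneCoef :=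
  band_ext 10 (fun n hn r => conv_band coef0Inv_band coef0_band n hn r) oneCoef_band
    (by decide +kernel)

/-- The matrix of `x₀`. -/
def X0 : UTˣ where
  val := toeplitz coef0
  inv := toeplitz coef0Inv
  val_inv := by rw [toeplitz_mul, coef0_mul_inv, toeplitz_one]
  inv_val := by rw [toeplitz_mul, coef0_inv_mul, toeplitz_one]

/-- The block diagonal matrix of order `7` which permutes the matrices of the generators
cyclically by conjugation. -/
def Dg : UTˣ where
  val := toeplitz (diagCoef 1)
  inv := toeplitz (diagCoef 6)
  val_inv := by rw [toeplitz_diag_mul, toeplitz_diag_seven]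
  inv_val := by rw [toeplitz_diag_mul, toeplitz_diag_seven]

theorem Dg_pow_seven : Dg ^ 7 = 1 := by
  ext1
  rw [Units.val_pow_eq_pow_val, Units.val_one]
  exact (toeplitz_diag_one_pow 7).trans toeplitz_diag_seven

/-- The matrix of the generator `x_i`, `i ∈ ℤ/7`. -/
def X (i : ZMod 7) : UTˣ := (Dg ^ i.val)⁻¹ * X0 * Dg ^ i.val

theorem Dg_pow_mod (m : ℕ) : Dg ^ (m % 7) = Dg ^ m := by
  conv_rhs => rw [← Nat.mod_add_div m 7, pow_add, pow_mul, Dg_pow_seven, one_pow, mul_one]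

/-- The coefficients of a product `D ^ p * a * D ^ q` with powers of the block diagonal matrix. -/
def sandwich (p : ℕ) (a : ℕ → ZMod 3 → M3) (q : ℕ) : ℕ → ZMod 3 → M3 :=
  fun n r => diagBlock r ^ p * a n r * diagBlock (r + (n : ZMod 3)) ^ q

theorem toeplitz_sandwich (p : ℕ) (a : ℕ → ZMod 3 → M3) (q : ℕ) :
    toeplitz (diagCoef 1) ^ p * toeplitz a * toeplitz (diagCoef 1) ^ q =
      toeplitz (sandwich p a q) := by
  rw [toeplitz_diag_one_pow, toeplitz_diag_one_pow, toeplitz_mul, toeplitz_mul]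
  congr 1
  funext n r
  have h : ∀ m, conv (diagCoef p) a m r = diagBlock r ^ p * a m r := by
    intro m
    unfold conv
    rw [Finset.sum_eq_single 0]
    · simp [diagCoef]
    · intro j _ hj
      simp [diagCoef, hj]
    · simp
  rw [show conv (conv (diagCoef p) a) (diagCoef q) n r =
    ∑ j ∈ Finset.range (n + 1), conv (diagCoef p) a j r *
      diagCoef q (n - j) (r + (j : ZMod 3)) from rfl, Finset.sum_eq_single n]
  · simp [diagCoef, h, sandwich]
  · intro j hj hjn
    have : n - j ≠ 0 := by
      have := Finset.mem_range.1 hj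
      omega
    simp [diagCoef, this]
  · simp

theorem sandwich_band {a : ℕ → ZMod 3 → M3} {N : ℕ} (ha : ∀ n, N < n → ∀ r, a n r = 0) (p q : ℕ) :
    ∀ n, N < n → ∀ r, sandwich p a q n r = 0 := by
  intro n hn r
  simp [sandwich, ha n hn r]

theorem coef0_relation : conv coef0 (sandwich 6 coef0 1) = sandwich 4 coef0Inv 3 :=
  band_ext 10
    (fun n hn r => conv_band coef0_band (sandwich_band coef0_band 6 1) n hn r)
    (fun n hn r => sandwich_band coef0Inv_band 4 3 n (by omega) r)
    (by decide +kernel)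

theorem X0_relation : X0 * (Dg ^ 6 * X0 * Dg) = Dg ^ 4 * X0⁻¹ * Dg ^ 3 := by
  ext1
  have h : toeplitz coef0 * (toeplitz (diagCoef 1) ^ 6 * toeplitz coef0 *
      toeplitz (diagCoef 1) ^ 1) =
      toeplitz (diagCoef 1) ^ 4 * toeplitz coef0Inv * toeplitz (diagCoef 1) ^ 3 := by
    rw [toeplitz_sandwich, toeplitz_sandwich, toeplitz_mul, coef0_relation]
  rw [pow_one] at h
  simp only [Units.val_mul, Units.val_pow_eq_pow_val]
  exact h

theorem X_relation (i : ZMod 7) : X i * X (i + 1) * X (i + 3) = 1 := by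
  have h1 : (Dg ^ (i + 1).val) = Dg ^ i.val * Dg := by
    rw [ZMod.val_add, Dg_pow_mod, show (1 : ZMod 7).val = 1 from rfl, pow_succ]
  have h3 : (Dg ^ (i + 3).val) = Dg ^ i.val * Dg ^ 3 := by
    rw [ZMod.val_add, Dg_pow_mod, show (3 : ZMod 7).val = 3 from rfl, pow_add]
  have e6 : Dg ^ 6 = Dg⁻¹ := by
    rw [eq_inv_iff_mul_eq_one, ← pow_succ, Dg_pow_seven]
  have e4 : Dg ^ 4 = (Dg ^ 3)⁻¹ := by
    rw [eq_inv_iff_mul_eq_one, ← pow_add, Dg_pow_seven]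
  have c : ∀ m n : ℕ, Dg ^ m * Dg ^ n = Dg ^ n * Dg ^ m := fun m n => by
    rw [← pow_add, ← pow_add, Nat.add_comm]
  have c1 : Dg ^ i.val * Dg = Dg * Dg ^ i.val := by simpa using c i.val 1
  have key := X0_relation
  rw [e6, e4] at key
  have key' : X0 * (Dg⁻¹ * X0 * Dg) * ((Dg ^ 3)⁻¹ * X0 * Dg ^ 3) = 1 := by
    rw [key]
    group
  unfold X
  rw [h1, h3, c1, c i.val 3]
  calc _ = (Dg ^ i.val)⁻¹ *
      (X0 * (Dg⁻¹ * X0 * Dg) * ((Dg ^ 3)⁻¹ * X0 * Dg ^ 3)) * Dg ^ i.val := by group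
    _ = 1 := by rw [key']; group

/-! ### The groups `G̃`, `G`, `G^k` and `G_k` -/

/-- The relators `x_i x_{i+1} x_{i+3}`, indices modulo `7`. -/
def relators : Set (FreeGroup (ZMod 7)) :=
  Set.range fun i => FreeGroup.of i * FreeGroup.of (i + 1) * FreeGroup.of (i + 3)

/-- `G̃ = ⟨x₀, …, x₆ ∣ x_i x_{i+1} x_{i+3}, i = 0, …, 6⟩`. -/
abbrev Gtilde : Type := PresentedGroup relators

/-- The generator `x_i` of `G̃`. -/
def x (i : ZMod 7) : Gtilde := PresentedGroup.of i

/-- The representation of `G̃` by infinite upper triangular matrices. -/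
def rho : Gtilde →* UTˣ :=
  PresentedGroup.toGroup (f := X) (by
    rintro _ ⟨i, rfl⟩
    simpa using X_relation i)

/-- The subgroup `G` of `G̃` generated by `x₀, x₁, x₃`. -/
def G : Subgroup Gtilde := Subgroup.closure {x 0, x 1, x 3}

/-- The invertible upper triangular matrices which agree with the identity matrix on the main
diagonal and on the first `k` upper diagonals. -/
def utLevel (k : ℕ) : Subgroup UTˣ where
  carrier := {u | ∀ i j : ℕ, j ≤ i + k → (u : UT) i j = (1 : UT) i j}
  one_mem' := fun _ _ _ => rfl
  mul_mem' := by
    intro u v hu hv i j hij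
    rw [Units.val_mul, IncidenceAlgebra.mul_apply, ← one_mul (1 : UT), IncidenceAlgebra.mul_apply]
    refine Finset.sum_congr rfl fun m hm => ?_
    rw [Finset.mem_Icc] at hm
    rw [hu i m (by omega), hv m j (by omega)]
  inv_mem' := by
    intro u hu i j hij
    have h : ∀ w : UT, (w * (u : UT)) i j = w i j := by
      intro w
      conv_rhs => rw [← mul_one w]
      rw [IncidenceAlgebra.mul_apply, IncidenceAlgebra.mul_apply]
      refine Finset.sum_congr rfl fun m hm => ?_
      rw [Finset.mem_Icc] at hm
      rw [hu m j (by omega)]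
    rw [← h, Units.inv_mul]

instance utLevel_normal (k : ℕ) : (utLevel k).Normal where
  conj_mem := by
    intro u hu v i j hij
    have h : ((v : UT) * (u : UT)) i j = (v : UT) i j := by
      conv_rhs => rw [← mul_one (v : UT)]
      rw [IncidenceAlgebra.mul_apply, IncidenceAlgebra.mul_apply]
      refine Finset.sum_congr rfl fun m hm => ?_
      rw [Finset.mem_Icc] at hm
      rw [hu m j (by omega)]
    rw [Units.val_mul, Units.val_mul, ← Units.mul_inv v, IncidenceAlgebra.mul_apply,
      IncidenceAlgebra.mul_apply]
    refine Finset.sum_congr rfl fun m hm => ?_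
    rw [Finset.mem_Icc] at hm
    congr 1
    conv_rhs => rw [← mul_one (v : UT)]
    rw [IncidenceAlgebra.mul_apply, IncidenceAlgebra.mul_apply]
    refine Finset.sum_congr rfl fun l hl => ?_
    rw [Finset.mem_Icc] at hl
    rw [hu l m (by omega)]

/-- The normal subgroup `G^k` of the elements of `G` whose matrices have vanishing first `k` upper
diagonals. (The main diagonal of the matrix of an element of `G` is the identity anyway.) -/
def level (k : ℕ) : Subgroup G := (utLevel k).comap (rho.comp G.subtype)

instance level_normal (k : ℕ) : (level k).Normal :=
  inferInstanceAs ((utLevel k).comap (rho.comp G.subtype)).Normal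

/-- The finite quotient `G_k = G / G^k`. -/
abbrev Gk (k : ℕ) : Type := G ⧸ level k

/-- The image in `G_k` of `x₀`. -/
def y0 (k : ℕ) : Gk k := QuotientGroup.mk ⟨x 0, Subgroup.subset_closure (by simp)⟩

/-- The image in `G_k` of `x₁`. -/
def y1 (k : ℕ) : Gk k := QuotientGroup.mk ⟨x 1, Subgroup.subset_closure (by simp)⟩

/-- The image in `G_k` of `x₃`. -/
def y3 (k : ℕ) : Gk k := QuotientGroup.mk ⟨x 3, Subgroup.subset_closure (by simp)⟩

/-! ### The surface `S_k` and its triangulation `T_k^*` -/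

/-- The two colours of the triangles. -/
inductive Colour : Type
  | white
  | black

/-- The disjoint union of the triangles from which `S_k` is glued: one white and one black triangle
for every element of `G_k`. A point of a triangle is given by its barycentric coordinates; side `i`
of the triangle is `{p | p i = 0}`, and the sides `0, 1, 2` carry the labels `x₀, x₁, x₃`. -/
abbrev Pieces (k : ℕ) : Type := Σ _ : Gk k × Colour, stdSimplex ℝ (Fin 3)

/-- The white triangle of `h` is the neighbour, across its side `i`, of the black triangle of
`h * across k i`. The black triangle of `h` fills in the triangle `h, h x₀, h x₀ x₁` (with
`x₀ x₁ x₃ = 1`) of the Cayley graph: its neighbours are the white triangles of these three elements,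
each of them across the side with the label of the edge of the Cayley graph triangle which is
opposite to that element. -/
def across (k : ℕ) : Fin 3 → Gk k := ![y3 k, 1, (y0 k)⁻¹]

/-- Corresponding points of adjacent sides are identified. -/
inductive Glue (k : ℕ) : Pieces k → Pieces k → Prop
  | side (h : Gk k) (i : Fin 3) (p : stdSimplex ℝ (Fin 3)) (hp : p.1 i = 0) :
      Glue k ⟨(h, Colour.white), p⟩ ⟨(h * across k i, Colour.black), p⟩

/-- The closed surface `S_k` (with the quotient topology). If all triangles are taken to be
congruent equilateral hyperbolic triangles with angles `π / ord x₀`, black ones being mirror images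
of white ones, then corresponding sides are identified isometrically and the total angle at every
vertex is `2 π`; this is the hyperbolic metric of `S_k`. In the projective model a hyperbolic
triangle is a Euclidean one, so that barycentric coordinates describe it as a topological space. -/
def Surface (k : ℕ) : Type := Quot (Glue k)

instance (k : ℕ) : TopologicalSpace (Surface k) :=
  inferInstanceAs (TopologicalSpace (Quot (Glue k)))

/-- Side `i` of a triangle, as a subset of the surface `S_k`. -/
def sideIn (k : ℕ) (t : Gk k × Colour) (i : Fin 3) : Set (Surface k) :=
  {s | ∃ p : stdSimplex ℝ (Fin 3), p.1 i = 0 ∧ s = Quot.mk (Glue k) ⟨t, p⟩}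

/-- The set of edges of the triangulation `T_k^*` of `S_k`: the sides of its triangles, as subsets
of the surface. -/
def dualEdges (k : ℕ) : Set (Set (Surface k)) :=
  Set.range fun a : (Gk k × Colour) × Fin 3 => sideIn k a.1 a.2

/-! ### The genus of a closed oriented surface -/

/-- A finite simplicial complex, given by its triangles, whose realization is a closed connected
orientable surface. -/
structure TriangulatedSurface (V : Type) [Fintype V] [DecidableEq V] where
  /-- The triangles, as sets of vertices. -/
  tri : Finset (Finset V)
  card_tri : ∀ t ∈ tri, t.card = 3
  nonempty : tri.Nonempty
  cover : ∀ v, ∃ t ∈ tri, v ∈ t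
  /-- Every edge lies in exactly two triangles. -/
  edge_two : ∀ e : Finset V, e.card = 2 → (∃ t ∈ tri, e ⊆ t) → (tri.filter (e ⊆ ·)).card = 2
  /-- The link of every vertex is connected, hence a cycle: any two triangles at a vertex are
  joined by a chain of triangles at this vertex, consecutive ones having a common edge there. -/
  link_connected : ∀ v, ∀ s ∈ tri, ∀ t ∈ tri, v ∈ s → v ∈ t →
    Relation.ReflTransGen
      (fun a b => a ∈ tri ∧ b ∈ tri ∧ v ∈ a ∩ b ∧ (a ∩ b).card = 2) s t
  /-- Any two triangles are joined by a chain of triangles, consecutive ones having a common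
  edge. -/
  connected : ∀ s ∈ tri, ∀ t ∈ tri,
    Relation.ReflTransGen (fun a b => a ∈ tri ∧ b ∈ tri ∧ (a ∩ b).card = 2) s t
  /-- The triangles can be oriented (`o a b c`: the triangle `a b c` is positively oriented) such
  that adjacent triangles induce opposite orientations on their common edge. -/
  orientable : ∃ o : V → V → V → Prop,
    (∀ a b c, {a, b, c} ∈ tri → o a b c → o b c a) ∧
    (∀ a b c, {a, b, c} ∈ tri → (o b a c ↔ ¬ o a b c)) ∧
    (∀ a b c d, {a, b, c} ∈ tri → {a, b, d} ∈ tri → c ≠ d → o a b c → o b a d)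

namespace TriangulatedSurface

variable {V : Type} [Fintype V] [DecidableEq V]

/-- The edges. -/
def edges (K : TriangulatedSurface V) : Finset (Finset V) :=
  Finset.univ.filter fun e => e.card = 2 ∧ ∃ t ∈ K.tri, e ⊆ t

/-- The Euler characteristic `V - E + F`. -/
def eulerChar (K : TriangulatedSurface V) : ℤ :=
  (Fintype.card V : ℤ) - (K.edges.card : ℤ) + (K.tri.card : ℤ)

/-- The geometric realization: all points of the standard simplex on the vertex set which are
supported in a triangle. -/
def realization (K : TriangulatedSurface V) : Set (V → ℝ) :=
  {w | w ∈ stdSimplex ℝ V ∧ ∃ t ∈ K.tri, ∀ v, w v ≠ 0 → v ∈ t}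

end TriangulatedSurface

/-- `S` is a closed connected orientable surface of genus `g`: it has a finite triangulation, of
Euler characteristic `2 - 2 g`. (By the topological invariance of the Euler characteristic, every
triangulation then has this Euler characteristic, so there is at most one such `g`.) -/
def HasGenus (S : Type) [TopologicalSpace S] (g : ℕ) : Prop :=
  ∃ (n : ℕ) (K : TriangulatedSurface (Fin n)),
    Nonempty (S ≃ₜ K.realization) ∧ K.eulerChar = 2 - 2 * (g : ℤ)

end ExpanderSurface

/-!
Let `N = |G_k|`, and let `M` be the order of `x₀` in `G_k`. The surface `S_k` is glued from `2 N`
triangles along `3 N` edges. The triangles around a corner form a cycle, in which multiplication by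
`x₀`, `x₁` or `x₃` leads from a white triangle to the next white one. The matrices of these
generators are conjugate under powers of `D`, so they have the same order `M`, and there are
`3 N / M` vertices. Hence
`2 - 2 g = 3 N / M - N` and `6 g / (3 N) = 1 + 2 / N - 3 / M`, which tends to one as soon as
`M` tends to infinity.

Modulo `2` one has `(1 + P) ^ (2 ^ n) = 1 + P ^ (2 ^ n)`. The matrix of `x₀` is `1 + P` where the
first upper diagonal of `P` is constant, with the block `A`; as `A` is not nilpotent, the first
nonzero diagonal of `P ^ (2 ^ n)` is the `2 ^ n`-th one, with the block `A ^ (2 ^ n)`. So `M` is the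
least power of two above `k` (`orderOf_rot`). The same diagonal of `x_i ^ (2 ^ n)` arises from it
by conjugation with `D ^ i`, which changes it. Therefore the involutions of the cyclic groups
generated by `x₀`, `x₁` and `x₃` are different, and these groups meet trivially
(`eq_one_of_mem_zpowers_rot`).

The last fact says that the triangulation `T_k^*` is a simplicial complex: with the cosets of the
three cyclic groups as vertices, a triangle is determined by its vertices and an edge by its
two end points (`cosetLabelling`). So `T_k^*` itself computes the genus
(`VertexLabelling.toSurface`, `VertexLabelling.nonempty_homeomorph`). The Euler characteristic is even because `G_k` is a
noncyclic `2`-group, whence `N / M` is even.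
-/

namespace ExpanderSurface

/-! ### Powers of unipotent matrices -/

theorem pow_apply_of_lt {M : UT} (hM : ∀ i, M i i = 0) (m : ℕ) :
    ∀ {i j : ℕ}, j < i + m → (M ^ m) i j = 0 := by
  induction m with
  | zero =>
    intro i j h
    rw [pow_zero, IncidenceAlgebra.one_apply, if_neg (by omega)]
  | succ m ih =>
    intro i j h
    rw [pow_succ, IncidenceAlgebra.mul_apply]
    refine Finset.sum_eq_zero fun l hl => ?_
    rw [Finset.mem_Icc] at hl
    by_cases h' : l < i + m
    · rw [ih h', zero_mul]
    · rw [show l = j by omega, hM, mul_zero]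

/-- The first possibly nonzero diagonal of the `m`-th power of a strictly upper triangular matrix
whose first diagonal is constant. -/
theorem pow_apply_add {M : UT} (hM : ∀ i, M i i = 0) {B : M3} (hB : ∀ i, M i (i + 1) = B) (m : ℕ) :
    ∀ i : ℕ, (M ^ m) i (i + m) = B ^ m := by
  induction m with
  | zero =>
    intro i
    rw [pow_zero, pow_zero, IncidenceAlgebra.one_apply, if_pos (add_zero i).symm]
  | succ m ih =>
    intro i
    rw [pow_succ, IncidenceAlgebra.mul_apply, Finset.sum_eq_single (i + m)]
    · rw [ih, ← add_assoc, hB, pow_succ]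
    · intro l hl hne
      rw [Finset.mem_Icc] at hl
      by_cases h' : l < i + m
      · rw [pow_apply_of_lt hM m h', zero_mul]
      · rw [show l = i + (m + 1) by omega, hM, mul_zero]
    · intro h
      exact absurd (Finset.mem_Icc.2 ⟨by omega, by omega⟩) h

theorem one_add_pow_two_pow (M : UT) (n : ℕ) : (1 + M) ^ 2 ^ n = 1 + M ^ 2 ^ n := by
  have h2 : ∀ P : UT, P + P = 0 := by
    intro P
    ext1 i j _
    exact CharTwo.add_self_eq_zero (P i j)
  induction n with
  | zero => simp
  | succ n ih =>
    rw [pow_succ, pow_mul, ih, pow_mul, sq, mul_add, mul_one, add_mul, one_mul, ← sq, add_assoc,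
      ← add_assoc (M ^ 2 ^ n), h2, zero_add]

theorem pow_two_pow_apply {u : UT} (hu : ∀ i, u i i = 1) {n i j : ℕ} (h : j < i + 2 ^ n) :
    (u ^ 2 ^ n) i j = (1 : UT) i j := by
  have h0 : ∀ i, (u - 1) i i = 0 := fun i => by
    rw [IncidenceAlgebra.sub_apply, hu, IncidenceAlgebra.one_apply, if_pos rfl, sub_self]
  conv_lhs => rw [← add_sub_cancel (1 : UT) u]
  rw [one_add_pow_two_pow, IncidenceAlgebra.add_apply, pow_apply_of_lt h0 _ h, add_zero]

theorem pow_two_pow_apply_add {u : UT} (hu : ∀ i, u i i = 1) {B : M3}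
    (hB : ∀ i, u i (i + 1) = B) (n i : ℕ) : (u ^ 2 ^ n) i (i + 2 ^ n) = B ^ 2 ^ n := by
  have h0 : ∀ i, (u - 1) i i = 0 := fun i => by
    rw [IncidenceAlgebra.sub_apply, hu, IncidenceAlgebra.one_apply, if_pos rfl, sub_self]
  have h1 : ∀ i, (u - 1) i (i + 1) = B := fun i => by
    rw [IncidenceAlgebra.sub_apply, hB, IncidenceAlgebra.one_apply, if_neg (by omega), sub_zero]
  conv_lhs => rw [← add_sub_cancel (1 : UT) u]
  rw [one_add_pow_two_pow, IncidenceAlgebra.add_apply, pow_apply_add h0 h1,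
    IncidenceAlgebra.one_apply, if_neg (by have := Nat.two_pow_pos n; omega), zero_add]

theorem pow_two_pow_mem_utLevel {u : UTˣ} (hu : u ∈ utLevel 0) {k n : ℕ} (h : k < 2 ^ n) :
    u ^ 2 ^ n ∈ utLevel k := by
  intro i j hij
  rw [Units.val_pow_eq_pow_val]
  refine pow_two_pow_apply (fun i => ?_) (by omega)
  rw [hu i i le_rfl, IncidenceAlgebra.one_apply, if_pos rfl]

/-- Two invertible matrices are congruent modulo `utLevel k` exactly when they agree on the main
diagonal and on the first `k` upper diagonals. -/
theorem inv_mul_mem_utLevel {u v : UTˣ} {k : ℕ} :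
    u⁻¹ * v ∈ utLevel k ↔ ∀ i j : ℕ, j ≤ i + k → (u : UT) i j = (v : UT) i j := by
  constructor
  · intro h i j hij
    have hv : (v : UT) = (u : UT) * ((u⁻¹ * v : UTˣ) : UT) := by
      rw [← Units.val_mul, mul_inv_cancel_left]
    rw [hv, ← mul_one (u : UT), mul_assoc, one_mul, IncidenceAlgebra.mul_apply,
      IncidenceAlgebra.mul_apply]
    refine Finset.sum_congr rfl fun l hl => ?_
    rw [Finset.mem_Icc] at hl
    rw [h l j (by omega)]
  · intro h i j hij
    rw [← Units.inv_mul u, Units.val_mul, IncidenceAlgebra.mul_apply, IncidenceAlgebra.mul_apply]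
    refine Finset.sum_congr rfl fun l hl => ?_
    rw [Finset.mem_Icc] at hl
    rw [h l j (by omega)]

/-! ### The matrices of the generators -/

theorem X0_mem_utLevel : X0 ∈ utLevel 0 := by
  intro i j hij
  change toeplitz coef0 i j = _
  simp only [toeplitz, IncidenceAlgebra.coe_mk, IncidenceAlgebra.one_apply]
  by_cases h : i ≤ j
  · obtain rfl : i = j := by omega
    simp [coef0]
  · rw [if_neg h, if_neg (by omega)]

theorem X_mem_utLevel (i : ZMod 7) : X i ∈ utLevel 0 := by
  have := (utLevel_normal 0).conj_mem X0 X0_mem_utLevel (Dg ^ i.val)⁻¹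
  rwa [inv_inv] at this

theorem X_pow (i : ZMod 7) (m : ℕ) : X i ^ m = (Dg ^ i.val)⁻¹ * X0 ^ m * Dg ^ i.val := by
  have := conj_pow (i := m) (a := (Dg ^ i.val)⁻¹) (b := X0)
  rwa [inv_inv] at this

theorem X_pow_mem_utLevel (i : ZMod 7) (m k : ℕ) : X i ^ m ∈ utLevel k ↔ X0 ^ m ∈ utLevel k := by
  rw [X_pow, (utLevel_normal k).mem_comm_iff, mul_inv_cancel_left]

theorem X0_pow_two_pow_apply (n r : ℕ) :
    ((X0 ^ 2 ^ n : UTˣ) : UT) r (r + 2 ^ n) = A ^ 2 ^ n := by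
  rw [Units.val_pow_eq_pow_val]
  refine pow_two_pow_apply_add (fun i => ?_) (fun i => ?_) n r
  · rw [X0_mem_utLevel i i le_rfl, IncidenceAlgebra.one_apply, if_pos rfl]
  · change toeplitz coef0 i (i + 1) = A
    simp [toeplitz, coef0]

/-- As `A` satisfies `A ^ 4 = A`, only the parity of `n` matters. -/
theorem two_pow_cases (n : ℕ) : ((2 ^ n : ℕ) : ZMod 3) = 1 ∧ A ^ 2 ^ n = A ∨
    ((2 ^ n : ℕ) : ZMod 3) = 2 ∧ A ^ 2 ^ n = A ^ 2 := by
  have h4 : (A ^ 2) ^ 2 = A := by decide +kernel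
  induction n with
  | zero => left; simp
  | succ n ih =>
    rcases ih with ⟨h, hA⟩ | ⟨h, hA⟩
    · right
      rw [pow_succ, pow_mul, hA, Nat.cast_mul, h]
      exact ⟨rfl, rfl⟩
    · left
      rw [pow_succ, pow_mul, hA, Nat.cast_mul, h]
      exact ⟨rfl, h4⟩

theorem X0_pow_two_pow_mem_utLevel (n k : ℕ) : X0 ^ 2 ^ n ∈ utLevel k ↔ k < 2 ^ n := by
  refine ⟨fun h => ?_, pow_two_pow_mem_utLevel X0_mem_utLevel⟩
  by_contra! hk
  have h1 := h 0 (0 + 2 ^ n) (by omega)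
  rw [X0_pow_two_pow_apply, IncidenceAlgebra.one_apply,
    if_neg (by have := Nat.two_pow_pos n; omega)] at h1
  rcases two_pow_cases n with ⟨-, h2⟩ | ⟨-, h2⟩ <;> rw [h2] at h1 <;> revert h1 <;> decide +kernel

theorem val_Dg_pow (m : ℕ) : ((Dg ^ m : UTˣ) : UT) = toeplitz (diagCoef m) := by
  rw [Units.val_pow_eq_pow_val]
  exact toeplitz_diag_one_pow m

theorem Dg_pow_mul_apply (m : ℕ) (u : UT) {i j : ℕ} (h : i ≤ j) :
    (((Dg ^ m : UTˣ) : UT) * u) i j = diagBlock i ^ m * u i j := by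
  rw [val_Dg_pow, IncidenceAlgebra.mul_apply, Finset.sum_eq_single i]
  · simp [toeplitz, diagCoef]
  · intro l hl hne
    rw [Finset.mem_Icc] at hl
    simp only [toeplitz, diagCoef, IncidenceAlgebra.coe_mk]
    rw [if_pos hl.1, if_neg (by omega), zero_mul]
  · intro h'
    exact absurd (Finset.mem_Icc.2 ⟨le_rfl, h⟩) h'

theorem mul_Dg_pow_apply (m : ℕ) (u : UT) {i j : ℕ} (h : i ≤ j) :
    (u * ((Dg ^ m : UTˣ) : UT)) i j = u i j * diagBlock j ^ m := by
  rw [val_Dg_pow, IncidenceAlgebra.mul_apply, Finset.sum_eq_single j]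
  · simp [toeplitz, diagCoef]
  · intro l hl hne
    rw [Finset.mem_Icc] at hl
    simp only [toeplitz, diagCoef, IncidenceAlgebra.coe_mk]
    rw [if_pos hl.2, if_neg (by omega), mul_zero]
  · intro h'
    exact absurd (Finset.mem_Icc.2 ⟨h, le_rfl⟩) h'

/-- Conjugation by `D ^ d` changes the first nonzero diagonal of `x₀ ^ (2 ^ n)`. -/
theorem not_Dg_conj_mem_utLevel {d : ℕ} (hd : d = 1 ∨ d = 2 ∨ d = 3) {n k : ℕ} (hn : 2 ^ n ≤ k) :
    (X0 ^ 2 ^ n)⁻¹ * ((Dg ^ d)⁻¹ * X0 ^ 2 ^ n * Dg ^ d) ∉ utLevel k := by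
  intro h
  have h' : (Dg ^ d * X0 ^ 2 ^ n)⁻¹ * (X0 ^ 2 ^ n * Dg ^ d) ∈ utLevel k := by
    rwa [mul_inv_rev, mul_assoc, ← mul_assoc (Dg ^ d)⁻¹]
  have e := inv_mul_mem_utLevel.1 h' 0 (0 + 2 ^ n) (by omega)
  rw [Units.val_mul, Units.val_mul, Dg_pow_mul_apply _ _ (Nat.le_add_right _ _),
    mul_Dg_pow_apply _ _ (Nat.le_add_right _ _), X0_pow_two_pow_apply, zero_add, Nat.cast_zero] at e
  revert e
  rcases two_pow_cases n with ⟨h1, h2⟩ | ⟨h1, h2⟩ <;> rw [h1, h2] <;>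
    rcases hd with rfl | rfl | rfl <;> decide +kernel

theorem X_pow_two_pow_not_congr {i j : ZMod 7} (hij : i.val < j.val) (hj : j.val ≤ i.val + 3)
    {n k : ℕ} (hn : 2 ^ n ≤ k) : (X i ^ 2 ^ n)⁻¹ * X j ^ 2 ^ n ∉ utLevel k := by
  obtain ⟨d, hd⟩ := Nat.exists_eq_add_of_lt hij
  intro h
  refine not_Dg_conj_mem_utLevel (d := d + 1) (by omega) hn ?_
  rw [X_pow, X_pow, hd] at h
  have := (utLevel_normal k).conj_mem _ h (Dg ^ i.val)
  rw [add_assoc, pow_add] at this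
  convert this using 1
  have c : Dg ^ i.val * Dg ^ (d + 1) = Dg ^ (d + 1) * Dg ^ i.val := by
    rw [← pow_add, ← pow_add, Nat.add_comm]
  rw [c]
  group

/-! ### Triangulated surfaces from labelled triangles -/

instance decidableEqColour : DecidableEq Colour := fun c d => by
  cases c <;> cases d <;> first | exact isTrue rfl | exact isFalse (by simp)

instance fintypeColour : Fintype Colour :=
  ⟨{Colour.white, Colour.black}, fun c => by cases c <;> simp⟩

theorem card_colour : Fintype.card Colour = 2 := Finset.card_pair (by simp)

/-- The neighbour of a triangle across its side `i`, where the white triangle of `h` is glued to the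
black triangle of `h * a i` along the side `i`. -/
def nbr {H : Type} [Group H] (a : Fin 3 → H) : H × Colour → Fin 3 → H × Colour
  | (h, Colour.white), i => (h * a i, Colour.black)
  | (h, Colour.black), i => (h * (a i)⁻¹, Colour.white)

theorem nbr_ne {H : Type} [Group H] (a : Fin 3 → H) (t : H × Colour) (i : Fin 3) :
    nbr a t i ≠ t := fun h => by
  have := congrArg Prod.snd h
  rcases t with ⟨h, _ | _⟩ <;> simp [nbr] at this

/-- The orientation of a triangle: the cyclic order of its corners is `0, 1, 2` for white triangles
and `0, 2, 1` for black ones. -/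
def sgn {H : Type} : H × Colour → Fin 3
  | (_, Colour.white) => 1
  | (_, Colour.black) => -1

theorem sgn_ne_zero {H : Type} (t : H × Colour) : sgn t ≠ 0 := by
  rcases t with ⟨h, _ | _⟩ <;> simp [sgn]

theorem sgn_nbr {H : Type} [Group H] (a : Fin 3 → H) (t : H × Colour) (i : Fin 3) :
    sgn (nbr a t i) = -sgn t := by
  rcases t with ⟨h, _ | _⟩ <;> rfl

/-- A labelling of the corners of the glued triangles by a set `V` of vertices, such that two
corners carry the same label exactly when they are identified by the gluing, and such that the
triangles form a simplicial complex: the triangles which share a given nonempty set of vertices are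
linked by crossing sides that contain these vertices. -/
structure VertexLabelling {H : Type} [Group H] (a : Fin 3 → H) (V : Type) where
  /-- The vertex at corner `i` of a triangle; this corner is opposite to side `i`. -/
  vert : H × Colour → Fin 3 → V
  /-- The corner at which a vertex sits in each triangle that contains it. -/
  typ : V → Fin 3
  typ_vert : ∀ t i, typ (vert t i) = i
  exists_vert : ∀ v, ∃ t, vert t (typ v) = v
  vert_nbr : ∀ t {i j}, j ≠ i → vert (nbr a t i) j = vert t j
  vert_nbr_self_ne : ∀ t i, vert (nbr a t i) i ≠ vert t i
  eq_or_eq_nbr : ∀ s t i, (∀ j, j ≠ i → vert s j = vert t j) → s = t ∨ s = nbr a t i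
  chain_vertex : ∀ s t j, vert s j = vert t j →
    Relation.ReflTransGen (fun c d => ∃ i, i ≠ j ∧ d = nbr a c i) s t
  chain : ∀ s t, Relation.ReflTransGen (fun c d => ∃ i, d = nbr a c i) s t

namespace VertexLabelling

variable {H : Type} [Group H] {a : Fin 3 → H} {V : Type}

/-- The same labelling, with renamed vertices. -/
def map {W : Type} (L : VertexLabelling a V) (e : V ≃ W) : VertexLabelling a W where
  vert t i := e (L.vert t i)
  typ w := L.typ (e.symm w)
  typ_vert t i := by rw [e.symm_apply_apply, L.typ_vert]
  exists_vert w := by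
    obtain ⟨t, ht⟩ := L.exists_vert (e.symm w)
    exact ⟨t, by rw [ht, e.apply_symm_apply]⟩
  vert_nbr t _ _ h := by rw [L.vert_nbr t h]
  vert_nbr_self_ne t i h := L.vert_nbr_self_ne t i (e.injective h)
  eq_or_eq_nbr s t i h := L.eq_or_eq_nbr s t i fun j hj => e.injective (h j hj)
  chain_vertex s t j h := L.chain_vertex s t j (e.injective h)
  chain := L.chain

variable (L : VertexLabelling a V)

theorem ext_vert {s t : H × Colour} (h : ∀ j, L.vert s j = L.vert t j) : s = t := by
  rcases L.eq_or_eq_nbr s t 0 fun j _ => h j with h' | rfl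
  · exact h'
  · exact absurd (h 0) (L.vert_nbr_self_ne t 0)

theorem vert_injective (t : H × Colour) : Function.Injective (L.vert t) := fun i j h => by
  rw [← L.typ_vert t i, h, L.typ_vert]

variable [DecidableEq V]

/-- The set of vertices of a triangle. -/
def vertexSet (t : H × Colour) : Finset V := Finset.univ.image (L.vert t)

/-- The set of vertices of side `i` of a triangle. -/
def side (t : H × Colour) (i : Fin 3) : Finset V := (L.vertexSet t).erase (L.vert t i)

theorem mem_vertexSet {t : H × Colour} {v : V} :
    v ∈ L.vertexSet t ↔ L.vert t (L.typ v) = v := by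
  simp only [vertexSet, Finset.mem_image, Finset.mem_univ, true_and]
  constructor
  · rintro ⟨i, rfl⟩
    rw [L.typ_vert]
  · exact fun h => ⟨_, h⟩

theorem vert_mem_vertexSet (t : H × Colour) (i : Fin 3) : L.vert t i ∈ L.vertexSet t :=
  Finset.mem_image_of_mem _ (Finset.mem_univ i)

theorem vert_mem_vertexSet_iff {s t : H × Colour} {i : Fin 3} :
    L.vert t i ∈ L.vertexSet s ↔ L.vert s i = L.vert t i := by
  rw [mem_vertexSet, L.typ_vert]

theorem card_vertexSet (t : H × Colour) : (L.vertexSet t).card = 3 := by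
  rw [vertexSet, Finset.card_image_of_injective _ (L.vert_injective t), Finset.card_univ,
    Fintype.card_fin]

theorem vertexSet_injective : Function.Injective L.vertexSet := fun s t h =>
  L.ext_vert fun j => by
    rw [← vert_mem_vertexSet_iff, h]
    exact L.vert_mem_vertexSet t j

theorem mem_side {t : H × Colour} {i : Fin 3} {v : V} :
    v ∈ L.side t i ↔ ∃ j, j ≠ i ∧ L.vert t j = v := by
  simp only [side, Finset.mem_erase, vertexSet, Finset.mem_image, Finset.mem_univ, true_and]
  constructor
  · rintro ⟨h, j, rfl⟩
    exact ⟨j, fun hj => h (by rw [hj]), rfl⟩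
  · rintro ⟨j, hj, rfl⟩
    exact ⟨fun h => hj (L.vert_injective t h), j, rfl⟩

theorem card_side (t : H × Colour) (i : Fin 3) : (L.side t i).card = 2 := by
  rw [side, Finset.card_erase_of_mem (L.vert_mem_vertexSet t i), L.card_vertexSet]

theorem side_subset_iff {s t : H × Colour} {i : Fin 3} :
    L.side t i ⊆ L.vertexSet s ↔ s = t ∨ s = nbr a t i := by
  constructor
  · intro h
    refine L.eq_or_eq_nbr s t i fun j hj => ?_
    rw [← vert_mem_vertexSet_iff]
    exact h (L.mem_side.2 ⟨j, hj, rfl⟩)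
  · rintro h v hv
    obtain ⟨j, hj, rfl⟩ := L.mem_side.1 hv
    rw [vert_mem_vertexSet_iff]
    rcases h with rfl | rfl
    · rfl
    · exact L.vert_nbr t hj

theorem side_nbr (t : H × Colour) (i : Fin 3) : L.side (nbr a t i) i = L.side t i := by
  ext v
  simp only [mem_side]
  refine exists_congr fun j => and_congr_right fun hj => ?_
  rw [L.vert_nbr t hj]

theorem exists_eq_side {t : H × Colour} {e : Finset V} (he : e.card = 2)
    (h : e ⊆ L.vertexSet t) : ∃ i, e = L.side t i := by
  obtain ⟨v, hv, hve⟩ := Finset.exists_mem_notMem_of_card_lt_card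
    (show e.card < (L.vertexSet t).card by rw [he, L.card_vertexSet]; norm_num)
  refine ⟨L.typ v, Finset.eq_of_subset_of_card_le (fun w hw => ?_) ?_⟩
  · rw [side, L.mem_vertexSet.1 hv]
    exact Finset.mem_erase.2 ⟨fun h' => hve (h' ▸ hw), h hw⟩
  · rw [L.card_side, he]

theorem inter_nbr (t : H × Colour) (i : Fin 3) :
    L.vertexSet t ∩ L.vertexSet (nbr a t i) = L.side t i := by
  refine (Finset.eq_of_subset_of_card_le (Finset.subset_inter (L.side_subset_iff.2 (Or.inl rfl))
    (L.side_subset_iff.2 (Or.inr rfl))) ?_).symm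
  rw [L.card_side]
  have h : L.vertexSet t ∩ L.vertexSet (nbr a t i) ⊂ L.vertexSet t := by
    refine Finset.ssubset_iff_subset_ne.2 ⟨Finset.inter_subset_left, fun h => ?_⟩
    have := Finset.inter_eq_left.1 h (L.vert_mem_vertexSet t i)
    exact L.vert_nbr_self_ne t i (L.vert_mem_vertexSet_iff.1 this)
  have := Finset.card_lt_card h
  rw [L.card_vertexSet] at this
  omega

/-- The cyclic order `a, b, c` of the vertices of a triangle is its orientation. -/
def Oriented (v w u : V) : Prop :=
  ∃ t, L.vertexSet t = {v, w, u} ∧ L.typ w = L.typ v + sgn t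

theorem image_typ {t : H × Colour} {v w u : V} (h : L.vertexSet t = {v, w, u}) :
    ({L.typ v, L.typ w, L.typ u} : Finset (Fin 3)) = Finset.univ := by
  have := congrArg (Finset.image L.typ) h
  rw [Finset.image_insert, Finset.image_insert, Finset.image_singleton] at this
  rw [← this]
  ext i
  simp only [Finset.mem_univ, iff_true, Finset.mem_image]
  exact ⟨_, L.vert_mem_vertexSet t i, L.typ_vert t i⟩

theorem oriented_iff {t : H × Colour} {v w u : V} (h : L.vertexSet t = {v, w, u}) :
    L.Oriented v w u ↔ L.typ w = L.typ v + sgn t := by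
  constructor
  · rintro ⟨s, hs, hs'⟩
    rwa [← L.vertexSet_injective (hs.trans h.symm)]
  · exact fun h' => ⟨t, h, h'⟩

theorem oriented_rotate {t : H × Colour} {v w u : V} (h : L.vertexSet t = {v, w, u})
    (ho : L.Oriented v w u) : L.Oriented w u v := by
  have h' : L.vertexSet t = {w, u, v} := by
    rw [h]
    ext
    simp only [Finset.mem_insert, Finset.mem_singleton]
    tauto
  rw [L.oriented_iff h] at ho
  rw [L.oriented_iff h']
  have key : ∀ i j l s : Fin 3, ({i, j, l} : Finset (Fin 3)) = Finset.univ → s ≠ 0 →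
      j = i + s → l = j + s := by decide
  exact key _ _ _ _ (L.image_typ h) (sgn_ne_zero t) ho

theorem oriented_swap {t : H × Colour} {v w u : V} (h : L.vertexSet t = {v, w, u}) :
    L.Oriented w v u ↔ ¬ L.Oriented v w u := by
  have h' : L.vertexSet t = {w, v, u} := by
    rw [h, Finset.insert_comm]
  rw [L.oriented_iff h, L.oriented_iff h']
  have key : ∀ i j l s : Fin 3, ({i, j, l} : Finset (Fin 3)) = Finset.univ → s ≠ 0 →
      (i = j + s ↔ ¬ j = i + s) := by decide
  exact key _ _ _ _ (L.image_typ h) (sgn_ne_zero t)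

theorem oriented_adjacent {s t : H × Colour} {v w u u' : V} (ht : L.vertexSet t = {v, w, u})
    (hs : L.vertexSet s = {v, w, u'}) (hu : u ≠ u') (ho : L.Oriented v w u) :
    L.Oriented w v u' := by
  have hs' : L.vertexSet s = {w, v, u'} := by rw [hs, Finset.insert_comm]
  rw [L.oriented_iff ht] at ho
  rw [L.oriented_iff hs', ho]
  have mem : ∀ {x : V} {r : H × Colour} {y : V}, L.vertexSet r = {v, w, y} → (x = v ∨ x = w) →
      L.vert r (L.typ x) = x := by
    rintro x r y hr hx
    rw [← mem_vertexSet, hr]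
    rcases hx with rfl | rfl <;> simp
  have key : ∀ i j l : Fin 3, ({i, j, l} : Finset (Fin 3)) = Finset.univ →
      ∀ m, m ≠ l → m = i ∨ m = j := by decide
  have := L.eq_or_eq_nbr s t (L.typ u) fun j hj => by
    rcases key _ _ _ (L.image_typ ht) j hj with rfl | rfl
    · rw [mem hs (Or.inl rfl), mem ht (Or.inl rfl)]
    · rw [mem hs (Or.inr rfl), mem ht (Or.inr rfl)]
  rcases this with rfl | rfl
  · have h1 : L.vert s (L.typ u) = u := by rw [← mem_vertexSet, ht]; simp
    have h2 : L.vert s (L.typ u') = u' := by rw [← mem_vertexSet, hs]; simp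
    have key' : ∀ i j l m : Fin 3, ({i, j, l} : Finset (Fin 3)) = Finset.univ →
      ({i, j, m} : Finset (Fin 3)) = Finset.univ → l = m := by decide
    exact absurd (by rw [← h1, ← h2, key' _ _ _ _ (L.image_typ ht) (L.image_typ hs)]) hu
  · rw [sgn_nbr, add_neg_cancel_right]

/-- Different white triangles have no common sides. -/
theorem white_side_injective {h h' : H} {i i' : Fin 3}
    (e : ∀ v, v ∈ L.side (h, Colour.white) i ↔ v ∈ L.side (h', Colour.white) i') :
    h = h' ∧ i = i' := by
  have hj : ∀ j, j ≠ i → j ≠ i' ∧ L.vert (h', Colour.white) j = L.vert (h, Colour.white) j := by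
    intro j hj
    obtain ⟨j', hj', e'⟩ := L.mem_side.1 ((e _).1 (L.mem_side.2 ⟨j, hj, rfl⟩))
    have : j' = j := by rw [← L.typ_vert (h', Colour.white) j', e', L.typ_vert]
    subst this
    exact ⟨hj', e'⟩
  have hi : i = i' := by
    by_contra hne
    exact (hj i' (Ne.symm hne)).1 rfl
  subst hi
  refine ⟨?_, rfl⟩
  rcases L.eq_or_eq_nbr (h', Colour.white) (h, Colour.white) i fun j hji => (hj j hji).2 with e' | e'
  · exact (congrArg Prod.fst e').symm
  · exact absurd (congrArg Prod.snd e') (by simp [nbr])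

variable [Fintype H]

theorem mem_tri {e : Finset V} :
    e ∈ (Finset.univ.image L.vertexSet) ↔ ∃ t, L.vertexSet t = e := by
  simp

/-- The triangulated surface with the given triangles. -/
def toSurface [Fintype V] : TriangulatedSurface V where
  tri := Finset.univ.image L.vertexSet
  card_tri := by
    intro e he
    obtain ⟨t, rfl⟩ := L.mem_tri.1 he
    exact L.card_vertexSet t
  nonempty := ⟨L.vertexSet (1, Colour.white), L.mem_tri.2 ⟨_, rfl⟩⟩
  cover := by
    intro v
    obtain ⟨t, ht⟩ := L.exists_vert v
    exact ⟨_, L.mem_tri.2 ⟨t, rfl⟩, L.mem_vertexSet.2 ht⟩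
  edge_two := by
    rintro e he ⟨r, hr, her⟩
    obtain ⟨t, rfl⟩ := L.mem_tri.1 hr
    obtain ⟨i, rfl⟩ := L.exists_eq_side he her
    have : (Finset.univ.image L.vertexSet).filter (L.side t i ⊆ ·) =
        {L.vertexSet t, L.vertexSet (nbr a t i)} := by
      ext r
      simp only [Finset.mem_filter, mem_tri, Finset.mem_insert, Finset.mem_singleton]
      constructor
      · rintro ⟨⟨s, rfl⟩, hs⟩
        rcases L.side_subset_iff.1 hs with rfl | rfl
        · exact Or.inl rfl
        · exact Or.inr rfl
      · rintro (rfl | rfl)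
        · exact ⟨⟨_, rfl⟩, L.side_subset_iff.2 (Or.inl rfl)⟩
        · exact ⟨⟨_, rfl⟩, L.side_subset_iff.2 (Or.inr rfl)⟩
    rw [this, Finset.card_pair fun h => nbr_ne a t i (L.vertexSet_injective h).symm]
  link_connected := by
    intro v s' hs' t' ht' hvs hvt
    obtain ⟨s, rfl⟩ := L.mem_tri.1 hs'
    obtain ⟨t, rfl⟩ := L.mem_tri.1 ht'
    rw [mem_vertexSet] at hvs hvt
    have h := L.chain_vertex s t (L.typ v) (hvs.trans hvt.symm)
    clear hvt ht'
    -- every triangle of the chain still contains `v`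
    suffices Relation.ReflTransGen _ (L.vertexSet s) (L.vertexSet t) ∧
      L.vert t (L.typ v) = v from this.1
    induction h with
    | refl => exact ⟨.refl, hvs⟩
    | @tail c d _ hcd ih =>
      obtain ⟨i, hi, rfl⟩ := hcd
      have hd : L.vert (nbr a c i) (L.typ v) = v := by rw [L.vert_nbr c hi.symm, ih.2]
      refine ⟨ih.1.tail ⟨L.mem_tri.2 ⟨_, rfl⟩, L.mem_tri.2 ⟨_, rfl⟩, ?_, ?_⟩, hd⟩
      · exact Finset.mem_inter.2 ⟨L.mem_vertexSet.2 ih.2, L.mem_vertexSet.2 hd⟩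
      · rw [L.inter_nbr, L.card_side]
  connected := by
    intro s' hs' t' ht'
    obtain ⟨s, rfl⟩ := L.mem_tri.1 hs'
    obtain ⟨t, rfl⟩ := L.mem_tri.1 ht'
    refine (L.chain s t).lift L.vertexSet ?_
    rintro c d ⟨i, rfl⟩
    exact ⟨L.mem_tri.2 ⟨_, rfl⟩, L.mem_tri.2 ⟨_, rfl⟩, by rw [L.inter_nbr, L.card_side]⟩
  orientable := by
    refine ⟨L.Oriented, fun v w u h => ?_, fun v w u h => ?_, fun v w u u' h h' => ?_⟩
    · obtain ⟨t, ht⟩ := L.mem_tri.1 h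
      exact L.oriented_rotate ht
    · obtain ⟨t, ht⟩ := L.mem_tri.1 h
      exact L.oriented_swap ht
    · obtain ⟨t, ht⟩ := L.mem_tri.1 h
      obtain ⟨s, hs⟩ := L.mem_tri.1 h'
      exact L.oriented_adjacent ht hs

theorem card_edges [Fintype V] : L.toSurface.edges.card = 3 * Fintype.card H := by
  have : L.toSurface.edges =
      Finset.univ.image fun p : H × Fin 3 => L.side (p.1, Colour.white) p.2 := by
    ext e
    simp only [TriangulatedSurface.edges, Finset.mem_filter, Finset.mem_univ, true_and,
      Finset.mem_image, Prod.exists]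
    constructor
    · rintro ⟨he, r, hr, her⟩
      obtain ⟨⟨h, c⟩, rfl⟩ := L.mem_tri.1 hr
      obtain ⟨i, rfl⟩ := L.exists_eq_side he her
      cases c with
      | white => exact ⟨h, i, rfl⟩
      | black => exact ⟨h * (a i)⁻¹, i, L.side_nbr (h, Colour.black) i⟩
    · rintro ⟨h, i, rfl⟩
      exact ⟨L.card_side _ i, _, L.mem_tri.2 ⟨_, rfl⟩, L.side_subset_iff.2 (Or.inl rfl)⟩
  rw [this, Finset.card_image_of_injective, Finset.card_univ, Fintype.card_prod, Fintype.card_fin,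
    mul_comm]
  rintro ⟨h, i⟩ ⟨h', i'⟩ e
  obtain ⟨h1, h2⟩ := L.white_side_injective (h := h) (h' := h') (i := i) (i' := i')
    fun v => by rw [show L.side (h, _) i = L.side (h', _) i' from e]
  rw [h1, h2]

theorem eulerChar_toSurface [Fintype V] :
    L.toSurface.eulerChar = (Fintype.card V : ℤ) - Fintype.card H := by
  have : L.toSurface.tri.card = Fintype.card H * 2 := by
    rw [show L.toSurface.tri = Finset.univ.image L.vertexSet from rfl,
      Finset.card_image_of_injective _ L.vertexSet_injective, Finset.card_univ,
      Fintype.card_prod, card_colour]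
  rw [TriangulatedSurface.eulerChar, L.card_edges, this]
  push_cast
  ring

end VertexLabelling

/-! ### Cosets as vertices -/

theorem add_one_ne : ∀ i : Fin 3, i + 1 ≠ i := by decide

theorem add_two_ne : ∀ i : Fin 3, i + 2 ≠ i := by decide

section Coset

variable {H : Type} [Group H] (a : Fin 3 → H)

theorem nbr_nbr (t : H × Colour) (i : Fin 3) : nbr a (nbr a t i) i = t := by
  rcases t with ⟨h, _ | _⟩ <;> simp [nbr]

theorem exists_white (t : H × Colour) (i : Fin 3) :
    ∃ h, t = (h, Colour.white) ∨ t = nbr a (h, Colour.white) i := by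
  rcases t with ⟨h, _ | _⟩
  · exact ⟨h, Or.inl rfl⟩
  · exact ⟨h * (a i)⁻¹, Or.inr (by simp [nbr])⟩

/-- The rotation about corner `j`: crossing the sides `j + 1` and `j + 2` leads from the white
triangle of `h` to the white triangle of `h * rot a j`. -/
def rot (j : Fin 3) : H := a (j + 1) * (a (j + 2))⁻¹

theorem chain_symm {p : Fin 3 → Prop} {s t : H × Colour}
    (h : Relation.ReflTransGen (fun c d => ∃ i, p i ∧ d = nbr a c i) s t) :
    Relation.ReflTransGen (fun c d => ∃ i, p i ∧ d = nbr a c i) t s := by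
  have : Std.Symm (fun c d => ∃ i, p i ∧ d = nbr a c i) := ⟨by
    rintro c d ⟨i, hi, rfl⟩
    exact ⟨i, hi, (nbr_nbr a c i).symm⟩⟩
  exact Std.Symm.symm (r := Relation.ReflTransGen _) _ _ h

theorem chain_rot {p : Fin 3 → Prop} {j : Fin 3} (h1 : p (j + 1)) (h2 : p (j + 2)) (h : H) :
    Relation.ReflTransGen (fun c d => ∃ i, p i ∧ d = nbr a c i)
      (h, Colour.white) (h * rot a j, Colour.white) :=
  .tail (.single ⟨j + 1, h1, rfl⟩) ⟨j + 2, h2, by simp [nbr, rot, mul_assoc]⟩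

theorem chain_of_mem_closure {p : Fin 3 → Prop} {S : Set H}
    (hS : ∀ z ∈ S, ∀ h : H, Relation.ReflTransGen (fun c d => ∃ i, p i ∧ d = nbr a c i)
      (h, Colour.white) (h * z, Colour.white)) {z : H} (hz : z ∈ Subgroup.closure S) :
    ∀ h : H, Relation.ReflTransGen (fun c d => ∃ i, p i ∧ d = nbr a c i)
      (h, Colour.white) (h * z, Colour.white) := by
  induction hz using Subgroup.closure_induction with
  | mem z hz => exact hS z hz
  | one => exact fun h => by rw [mul_one]
  | mul z w _ _ ihz ihw => exact fun h => by rw [← mul_assoc]; exact (ihz h).trans (ihw _)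
  | inv z _ ih =>
    intro h
    have := chain_symm a (ih (h * z⁻¹))
    rwa [inv_mul_cancel_right] at this

/-- The white triangle whose group element represents the coset of the vertex at corner `j`. -/
def base : H × Colour → Fin 3 → H
  | (h, Colour.white), _ => h
  | (h, Colour.black), j => h * (a (j + 1))⁻¹

/-- The vertex at corner `j` of a triangle: a left coset of the cyclic group generated by the
rotation about this corner. -/
def cosetVert (t : H × Colour) (j : Fin 3) : Σ j : Fin 3, H ⧸ Subgroup.zpowers (rot a j) :=
  ⟨j, QuotientGroup.mk (base a t j)⟩

theorem cosetVert_eq_iff {s t : H × Colour} {j : Fin 3} : cosetVert a s j = cosetVert a t j ↔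
    (base a s j)⁻¹ * base a t j ∈ Subgroup.zpowers (rot a j) := by
  rw [← QuotientGroup.eq]
  simp [cosetVert]

theorem cosetVert_nbr (t : H × Colour) {i j : Fin 3} (hij : j ≠ i) :
    cosetVert a (nbr a t i) j = cosetVert a t j := by
  have white : ∀ h : H, cosetVert a (nbr a (h, Colour.white) i) j =
      cosetVert a (h, Colour.white) j := by
    intro h
    rw [cosetVert_eq_iff]
    have : i = j + 1 ∨ i = j + 2 := by revert i j; decide
    rcases this with rfl | rfl
    · simp [base, nbr, one_mem]
    · convert Subgroup.mem_zpowers (rot a j) using 1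
      simp [base, nbr, rot, mul_assoc]
  obtain ⟨h, rfl | rfl⟩ := exists_white a t i
  · exact white h
  · rw [nbr_nbr, white]

theorem cosetVert_nbr_ne (hdisj : ∀ i j, i ≠ j → ∀ z ∈ Subgroup.zpowers (rot a i),
      z ∈ Subgroup.zpowers (rot a j) → z = 1)
    (hne : ∀ j, rot a j ≠ 1) (t : H × Colour) (i : Fin 3) :
    cosetVert a (nbr a t i) i ≠ cosetVert a t i := by
  have white : ∀ h : H, cosetVert a (h, Colour.white) i ≠
      cosetVert a (nbr a (h, Colour.white) i) i := by
    intro h e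
    rw [cosetVert_eq_iff] at e
    have e' : rot a (i + 2) ∈ Subgroup.zpowers (rot a i) := by
      convert e using 1
      have h1 : i + 2 + 1 = i := (by decide : ∀ i : Fin 3, i + 2 + 1 = i) i
      have h2 : i + 2 + 2 = i + 1 := (by decide : ∀ i : Fin 3, i + 2 + 2 = i + 1) i
      simp [base, nbr, rot, h1, h2, mul_assoc]
    exact hne _ (hdisj (i + 2) i (add_two_ne i) _ (Subgroup.mem_zpowers _) e')
  obtain ⟨h, rfl | rfl⟩ := exists_white a t i
  · exact (white h).symm
  · rw [nbr_nbr]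
    exact white h

theorem eq_or_eq_nbr_of_cosetVert (hdisj : ∀ i j, i ≠ j → ∀ z ∈ Subgroup.zpowers (rot a i),
      z ∈ Subgroup.zpowers (rot a j) → z = 1)
    (s t : H × Colour) (i : Fin 3)
    (hst : ∀ j, j ≠ i → cosetVert a s j = cosetVert a t j) : s = t ∨ s = nbr a t i := by
  have white : ∀ g h : H, (∀ j, j ≠ i → cosetVert a (g, Colour.white) j =
      cosetVert a (h, Colour.white) j) → g = h := by
    intro g h hgh
    have m : ∀ j, j ≠ i → g⁻¹ * h ∈ Subgroup.zpowers (rot a j) := fun j hj =>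
      (cosetVert_eq_iff a).1 (hgh j hj)
    exact inv_mul_eq_one.1 (hdisj (i + 1) (i + 2)
      ((by decide : ∀ i : Fin 3, i + 1 ≠ i + 2) i) _ (m _ (add_one_ne i)) (m _ (add_two_ne i)))
  obtain ⟨g, hs⟩ := exists_white a s i
  obtain ⟨h, ht⟩ := exists_white a t i
  have : g = h := by
    refine white g h fun j hj => ?_
    have hs' : cosetVert a s j = cosetVert a (g, Colour.white) j := by
      rcases hs with rfl | rfl
      · rfl
      · exact cosetVert_nbr a _ hj
    have ht' : cosetVert a t j = cosetVert a (h, Colour.white) j := by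
      rcases ht with rfl | rfl
      · rfl
      · exact cosetVert_nbr a _ hj
    rw [← hs', ← ht', hst j hj]
  subst this
  rcases hs with rfl | rfl <;> rcases ht with rfl | rfl
  · exact Or.inl rfl
  · exact Or.inr (nbr_nbr a _ i).symm
  · exact Or.inr rfl
  · exact Or.inl rfl

/-- Every triangle is linked to a white one by crossing at most the side `i`. -/
theorem exists_chain_white {p : Fin 3 → Prop} {i : Fin 3} (hi : p i) (t : H × Colour) :
    ∃ h, Relation.ReflTransGen (fun c d => ∃ i, p i ∧ d = nbr a c i) t (h, Colour.white) ∧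
      ∀ j, j ≠ i → cosetVert a t j = cosetVert a (h, Colour.white) j := by
  obtain ⟨h, rfl | rfl⟩ := exists_white a t i
  · exact ⟨h, .refl, fun _ _ => rfl⟩
  · exact ⟨h, .single ⟨i, hi, (nbr_nbr a _ i).symm⟩, fun j hj => cosetVert_nbr a _ hj⟩

theorem chain_of_cosetVert (s t : H × Colour) (j : Fin 3)
    (hst : cosetVert a s j = cosetVert a t j) :
    Relation.ReflTransGen (fun c d => ∃ i, i ≠ j ∧ d = nbr a c i) s t := by
  have h1 := add_one_ne j
  have h2 := add_two_ne j
  obtain ⟨g, hs, hs'⟩ := exists_chain_white a (p := (· ≠ j)) h1 s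
  obtain ⟨h, ht, ht'⟩ := exists_chain_white a (p := (· ≠ j)) h1 t
  rw [hs' j h1.symm, ht' j h1.symm, cosetVert_eq_iff, Subgroup.zpowers_eq_closure] at hst
  have := chain_of_mem_closure a (p := (· ≠ j)) (by
    rintro _ rfl
    exact chain_rot a h1 h2) hst g
  rw [show g * ((base a (g, Colour.white) j)⁻¹ * base a (h, Colour.white) j) = h from
    mul_inv_cancel_left g h] at this
  exact (hs.trans this).trans (chain_symm a ht)

theorem chain_of_closure (hgen : Subgroup.closure (Set.range (rot a)) = ⊤)
    (s t : H × Colour) :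
    Relation.ReflTransGen (fun c d => ∃ i, d = nbr a c i) s t := by
  obtain ⟨g, hs, -⟩ := exists_chain_white a (p := fun _ => True) (i := 0) trivial s
  obtain ⟨h, ht, -⟩ := exists_chain_white a (p := fun _ => True) (i := 0) trivial t
  have := chain_of_mem_closure a (p := fun _ => True) (S := Set.range (rot a)) (by
    rintro _ ⟨j, rfl⟩
    exact chain_rot a trivial trivial) (z := g⁻¹ * h) (by rw [hgen]; trivial) g
  rw [mul_inv_cancel_left] at this
  have all := (hs.trans this).trans (chain_symm a ht)
  simpa only [true_and] using all

/-- If the rotations about the three corners generate `H` and the cyclic groups generated by them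
are nontrivial and meet trivially, then the cosets of these groups are the vertices of a simplicial
complex. -/
def cosetLabelling (hdisj : ∀ i j, i ≠ j → ∀ z ∈ Subgroup.zpowers (rot a i),
      z ∈ Subgroup.zpowers (rot a j) → z = 1)
    (hne : ∀ j, rot a j ≠ 1) (hgen : Subgroup.closure (Set.range (rot a)) = ⊤) :
    VertexLabelling a (Σ j : Fin 3, H ⧸ Subgroup.zpowers (rot a j)) where
  vert := cosetVert a
  typ := Sigma.fst
  typ_vert _ _ := rfl
  exists_vert := by
    rintro ⟨j, q⟩
    induction q using QuotientGroup.induction_on with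
    | H h => exact ⟨(h, Colour.white), rfl⟩
  vert_nbr t _ _ h := cosetVert_nbr a t h
  vert_nbr_self_ne := cosetVert_nbr_ne a hdisj hne
  eq_or_eq_nbr := eq_or_eq_nbr_of_cosetVert a hdisj
  chain_vertex := chain_of_cosetVert a
  chain := chain_of_closure a hgen

end Coset

/-! ### The glued surface and its simplicial complex -/

namespace VertexLabelling

/-- The point of the realization that corresponds to a point of a triangle. -/
def bary {H : Type} [Group H] {a : Fin 3 → H} {V : Type} [DecidableEq V] (L : VertexLabelling a V)
    (t : H × Colour) (p : stdSimplex ℝ (Fin 3)) : V → ℝ :=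
  fun v => if L.vert t (L.typ v) = v then p.1 (L.typ v) else 0

section

variable {H : Type} [Group H] {a : Fin 3 → H} {V : Type} [DecidableEq V] (L : VertexLabelling a V)

theorem bary_vert (t : H × Colour) (p : stdSimplex ℝ (Fin 3)) (i : Fin 3) :
    L.bary t p (L.vert t i) = p.1 i := by
  simp [bary, L.typ_vert]

theorem bary_nbr (t : H × Colour) {p : stdSimplex ℝ (Fin 3)} {i : Fin 3} (hp : p.1 i = 0) :
    L.bary (nbr a t i) p = L.bary t p := by
  funext v
  by_cases h : L.typ v = i
  · simp [bary, h, hp]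
  · simp only [bary, L.vert_nbr t h]

theorem sum_bary [Fintype V] (t : H × Colour) (p : stdSimplex ℝ (Fin 3)) :
    ∑ v, L.bary t p v = 1 := by
  rw [← p.2.2, ← Finset.sum_subset (Finset.subset_univ (L.vertexSet t)), vertexSet,
    Finset.sum_image fun i _ j _ h => L.vert_injective t h]
  · exact Finset.sum_congr rfl fun i _ => L.bary_vert t p i
  · intro v _ hv
    rw [mem_vertexSet] at hv
    exact if_neg hv

theorem eq_of_bary_eq {s t : H × Colour} {p q : stdSimplex ℝ (Fin 3)}
    (h : L.bary s p = L.bary t q) : p = q ∧ ∀ i, p.1 i ≠ 0 → L.vert s i = L.vert t i := by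
  have key : ∀ {s t : H × Colour} {p q : stdSimplex ℝ (Fin 3)}, L.bary s p = L.bary t q →
      ∀ i, p.1 i ≠ 0 → L.vert t i = L.vert s i ∧ q.1 i = p.1 i := by
    intro s t p q h i hi
    have := congrFun h (L.vert s i)
    rw [bary_vert, bary, L.typ_vert] at this
    split_ifs at this with h'
    · exact ⟨h', this.symm⟩
    · exact absurd this hi
  refine ⟨?_, fun i hi => (key h i hi).1.symm⟩
  ext i
  by_cases hp : p.1 i = 0
  · by_cases hq : q.1 i = 0
    · exact hp.trans hq.symm
    · exact (key h.symm i hq).2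
  · exact (key h i hp).2.symm

end

section

variable {k : ℕ} {V : Type} [DecidableEq V] (L : VertexLabelling (across k) V)

theorem mk_nbr (t : Gk k × Colour) {p : stdSimplex ℝ (Fin 3)} {i : Fin 3} (hp : p.1 i = 0) :
    Quot.mk (Glue k) ⟨nbr (across k) t i, p⟩ = Quot.mk (Glue k) ⟨t, p⟩ := by
  rcases t with ⟨h, _ | _⟩
  · exact (Quot.sound (Glue.side h i p hp)).symm
  · have := Quot.sound (Glue.side (h * (across k i)⁻¹) i p hp)
    rwa [inv_mul_cancel_right] at this

/-- The map from the glued surface to the realization. -/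
def toReal : Surface k → V → ℝ :=
  Quot.lift (fun x => L.bary x.1 x.2) (by
    rintro _ _ ⟨h, i, p, hp⟩
    exact (L.bary_nbr (h, Colour.white) hp).symm)

theorem continuous_toReal : Continuous L.toReal := by
  refine continuous_quot_lift _ (continuous_sigma fun t => continuous_pi fun v => ?_)
  by_cases h : L.vert t (L.typ v) = v
  · simp only [bary, if_pos h]
    exact (continuous_apply _).comp continuous_subtype_val
  · simp only [bary, if_neg h]
    exact continuous_const

theorem toReal_injective : Function.Injective L.toReal := by
  rintro ⟨s, p⟩ ⟨t, q⟩ h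
  obtain ⟨rfl, hv⟩ := L.eq_of_bary_eq h
  change ∀ i, p.1 i ≠ 0 → L.vert s i = L.vert t i at hv
  change Quot.mk (Glue k) ⟨s, p⟩ = Quot.mk (Glue k) ⟨t, p⟩
  -- `p` is a corner, an inner point of a side, or an inner point of the triangle
  by_cases h1 : ∃ j, ∀ i, i ≠ j → p.1 i = 0
  · obtain ⟨j, hj⟩ := h1
    have hpj : p.1 j ≠ 0 := by
      intro h0
      have := p.2.2
      rw [Finset.sum_eq_zero fun i _ => ?_] at this
      · exact zero_ne_one this
      · by_cases hij : i = j
        · rw [hij]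
          exact h0
        · exact hj i hij
    have hc := L.chain_vertex s t j (hv j hpj)
    clear h hv
    induction hc with
    | refl => rfl
    | tail _ hcd ih =>
      obtain ⟨i, hi, rfl⟩ := hcd
      rw [ih, mk_nbr _ (hj i hi)]
  · by_cases h2 : ∃ i, p.1 i = 0
    · obtain ⟨i, hi⟩ := h2
      have hj : ∀ j, j ≠ i → p.1 j ≠ 0 := by
        intro j hj hj0
        refine h1 ?_
        obtain ⟨l, hl⟩ := (by decide : ∀ i j : Fin 3, j ≠ i → ∃ l, ∀ m, m ≠ l → m = i ∨ m = j) i j hj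
        refine ⟨l, fun m hm => ?_⟩
        rcases hl m hm with rfl | rfl
        · exact hi
        · exact hj0
      rcases L.eq_or_eq_nbr s t i fun j hji => hv j (hj j hji) with rfl | rfl
      · rfl
      · exact mk_nbr t hi
    · push Not at h2
      rw [L.ext_vert fun j => hv j (h2 j)]

theorem mem_side_iff_toReal {t : Gk k × Colour} {i : Fin 3} {v : V} :
    v ∈ L.side t i ↔ ∃ s ∈ sideIn k t i, L.toReal s v = 1 := by
  rw [mem_side]
  constructor
  · rintro ⟨j, hj, rfl⟩
    refine ⟨_, ⟨⟨Pi.single j 1, single_mem_stdSimplex ℝ j⟩, ?_, rfl⟩, ?_⟩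
    · exact Pi.single_eq_of_ne hj.symm _
    · exact (L.bary_vert _ _ _).trans (Pi.single_eq_same _ _)
  · rintro ⟨_, ⟨p, hp, rfl⟩, h⟩
    change (if L.vert t (L.typ v) = v then p.1 (L.typ v) else 0) = 1 at h
    split_ifs at h with h'
    · refine ⟨L.typ v, fun hi => ?_, h'⟩
      rw [hi, hp] at h
      exact zero_ne_one h
    · exact absurd h zero_ne_one

theorem ncard_dualEdges (L : VertexLabelling (across k) V) [Fintype (Gk k)] :
    (dualEdges k).ncard = 3 * Fintype.card (Gk k) := by
  have : dualEdges k =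
      (fun p : Gk k × Fin 3 => sideIn k (p.1, Colour.white) p.2) '' Set.univ := by
    ext e
    constructor
    · rintro ⟨⟨⟨h, c⟩, i⟩, rfl⟩
      cases c with
      | white => exact ⟨(h, i), trivial, rfl⟩
      | black =>
        refine ⟨(h * (across k i)⁻¹, i), trivial, ?_⟩
        ext s
        refine exists_congr fun p => and_congr_right fun hp => ?_
        rw [← mk_nbr (h, Colour.black) hp]
        rfl
    · rintro ⟨⟨h, i⟩, -, rfl⟩
      exact ⟨((h, Colour.white), i), rfl⟩
  rw [this, Set.ncard_image_of_injective, Set.ncard_univ, Nat.card_eq_fintype_card,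
    Fintype.card_prod, Fintype.card_fin, mul_comm]
  rintro ⟨h, i⟩ ⟨h', i'⟩ e
  obtain ⟨h1, h2⟩ := L.white_side_injective (h := h) (h' := h') (i := i) (i' := i') fun v => by
    rw [mem_side_iff_toReal, mem_side_iff_toReal,
      show sideIn k (h, Colour.white) i = sideIn k (h', Colour.white) i' from e]
  rw [h1, h2]

variable [Fintype V] [Fintype (Gk k)]

theorem range_toReal : Set.range L.toReal = L.toSurface.realization := by
  ext w
  constructor
  · rintro ⟨⟨t, p⟩, rfl⟩
    refine ⟨⟨fun v => ?_, L.sum_bary t p⟩, L.vertexSet t, L.mem_tri.2 ⟨t, rfl⟩, fun v hv => ?_⟩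
    · change 0 ≤ L.bary t p v
      unfold bary
      split_ifs
      · exact p.2.1 _
      · exact le_rfl
    · rw [mem_vertexSet]
      by_contra h
      exact hv (if_neg h)
  · rintro ⟨⟨hw0, hw1⟩, r, hr, hw⟩
    obtain ⟨t, rfl⟩ := L.mem_tri.1 hr
    refine ⟨Quot.mk _ ⟨t, fun i => w (L.vert t i), fun i => hw0 _, ?_⟩, ?_⟩
    · rw [← hw1, ← Finset.sum_subset (Finset.subset_univ (L.vertexSet t)), vertexSet,
        Finset.sum_image fun i _ j _ h => L.vert_injective t h]
      intro v _ hv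
      by_contra h
      exact hv (hw v h)
    · funext v
      change (if L.vert t (L.typ v) = v then w (L.vert t (L.typ v)) else 0) = w v
      split_ifs with h
      · rw [h]
      · by_contra h'
        exact h (L.mem_vertexSet.1 (hw v (Ne.symm h')))

/-- The realization of the simplicial complex is the glued surface, because a continuous bijection
from a compact space to a Hausdorff space is a homeomorphism. -/
theorem nonempty_homeomorph : Nonempty (Surface k ≃ₜ L.toSurface.realization) := by
  have : CompactSpace (Surface k) := inferInstanceAs (CompactSpace (Quot (Glue k)))
  have hmem : ∀ s, L.toReal s ∈ L.toSurface.realization := fun s => by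
    rw [← L.range_toReal]
    exact ⟨s, rfl⟩
  let f : Surface k → L.toSurface.realization := fun s => ⟨L.toReal s, hmem s⟩
  have hf : Continuous f := L.continuous_toReal.subtype_mk _
  have hb : Function.Bijective f := by
    refine ⟨fun s t h => L.toReal_injective (congrArg Subtype.val h), ?_⟩
    rintro ⟨w, hw⟩
    rw [← L.range_toReal] at hw
    obtain ⟨s, rfl⟩ := hw
    exact ⟨s, rfl⟩
  exact ⟨Continuous.homeoOfEquivCompactToT2 (f := Equiv.ofBijective f hb) hf⟩

end

theorem hasGenus {k : ℕ} {V : Type} (L : VertexLabelling (across k) V) [Fintype V]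
    [Fintype (Gk k)] {g : ℕ} (hg : (Fintype.card V : ℤ) - Fintype.card (Gk k) = 2 - 2 * (g : ℤ)) :
    HasGenus (Surface k) g := by
  let L' := L.map (Fintype.equivFin V)
  refine ⟨_, L'.toSurface, L'.nonempty_homeomorph, ?_⟩
  rw [L'.eulerChar_toSurface, Fintype.card_fin, hg]

end VertexLabelling

/-! ### The finite groups `G_k` -/

/-- The representation of `G`. -/
def rhoG : G →* UTˣ := rho.comp G.subtype

theorem rho_x (i : ZMod 7) : rho (x i) = X i := by
  simp [rho, x]

theorem closure_range_x : Subgroup.closure (Set.range x) = ⊤ :=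
  PresentedGroup.closure_range_of relators

theorem rho_mem {S : Subgroup UTˣ} (hS : ∀ i, X i ∈ S) (g : Gtilde) : rho g ∈ S := by
  have : Subgroup.closure (Set.range x) ≤ S.comap rho := by
    rw [Subgroup.closure_le]
    rintro _ ⟨i, rfl⟩
    change rho (x i) ∈ S
    rw [rho_x]
    exact hS i
  rw [closure_range_x] at this
  exact this (Subgroup.mem_top g)

/-- The invertible matrices that are, together with their inverses, `3`-periodic along diagonals. -/
def periodic : Subgroup UTˣ where
  carrier := {u | (∃ c, (u : UT) = toeplitz c) ∧ ∃ c, ((u⁻¹ : UTˣ) : UT) = toeplitz c}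
  one_mem' := ⟨⟨oneCoef, toeplitz_one.symm⟩,
    ⟨oneCoef, by rw [inv_one, Units.val_one, toeplitz_one]⟩⟩
  mul_mem' := by
    rintro u v ⟨⟨c, hc⟩, ⟨c', hc'⟩⟩ ⟨⟨d, hd⟩, ⟨d', hd'⟩⟩
    refine ⟨⟨conv c d, ?_⟩, ⟨conv d' c', ?_⟩⟩
    · rw [Units.val_mul, hc, hd, toeplitz_mul]
    · rw [mul_inv_rev, Units.val_mul, hc', hd', toeplitz_mul]
  inv_mem' := by
    rintro u ⟨h, h'⟩
    exact ⟨h', by rwa [inv_inv]⟩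

theorem X_mem_periodic (i : ZMod 7) : X i ∈ periodic := by
  have h0 : X0 ∈ periodic := ⟨⟨coef0, rfl⟩, ⟨coef0Inv, rfl⟩⟩
  have hD : Dg ∈ periodic := ⟨⟨_, rfl⟩, ⟨_, rfl⟩⟩
  exact mul_mem (mul_mem (inv_mem (pow_mem hD _)) h0) (pow_mem hD _)

theorem mk_eq_mk_iff {k : ℕ} {g h : G} : (QuotientGroup.mk g : Gk k) = QuotientGroup.mk h ↔
    (rhoG g)⁻¹ * rhoG h ∈ utLevel k := by
  rw [QuotientGroup.eq]
  change rhoG (g⁻¹ * h) ∈ utLevel k ↔ _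
  rw [map_mul, map_inv]

instance finite_Gk (k : ℕ) : Finite (Gk k) := by
  -- a periodic matrix is determined, up to its first `k` upper diagonals, by finitely many entries
  let f : Gk k → ZMod 3 → Fin (k + 1) → M3 := fun q r n => (rhoG q.out : UT) r.val (r.val + n)
  refine Finite.of_injective f fun p q h => ?_
  rw [← QuotientGroup.out_eq' p, ← QuotientGroup.out_eq' q, mk_eq_mk_iff, inv_mul_mem_utLevel]
  intro i j hij
  by_cases hle : i ≤ j
  · obtain ⟨⟨c, hc⟩, -⟩ := rho_mem X_mem_periodic (p.out : Gtilde)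
    obtain ⟨⟨d, hd⟩, -⟩ := rho_mem X_mem_periodic (q.out : Gtilde)
    have e := congrFun (congrFun h (i : ZMod 3)) ⟨j - i, by omega⟩
    change (rho p.out : UT) _ _ = (rho q.out : UT) _ _ at e
    change (rho p.out : UT) _ _ = (rho q.out : UT) _ _
    rw [hc, hd] at e ⊢
    simpa [toeplitz, hle] using e
  · rw [IncidenceAlgebra.apply_eq_zero_of_not_le hle, IncidenceAlgebra.apply_eq_zero_of_not_le hle]

theorem isPGroup_Gk (k : ℕ) : IsPGroup 2 (Gk k) := by
  intro q
  induction q using QuotientGroup.induction_on with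
  | H g =>
    refine ⟨k, ?_⟩
    rw [← QuotientGroup.mk_pow, QuotientGroup.eq_one_iff]
    change rhoG (g ^ 2 ^ k) ∈ utLevel k
    rw [map_pow]
    exact pow_two_pow_mem_utLevel (rho_mem X_mem_utLevel (g : Gtilde)) Nat.lt_two_pow_self

/-- The generators `x₀, x₁, x₃` of `G` have the indices `0, 1, 3`. -/
def idx : Fin 3 → ZMod 7 := ![0, 1, 3]

/-- The generators `x₀, x₁, x₃` of `G`. -/
def gen (j : Fin 3) : G :=
  ⟨x (idx j), Subgroup.subset_closure (by fin_cases j <;> simp [idx])⟩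

theorem rhoG_gen (j : Fin 3) : rhoG (gen j) = X (idx j) := rho_x _

/-- The rotations about the corners of the gluing pattern are the images of `x₀, x₁, x₃`; for the
corner `1` this is the relation `x₀ x₁ x₃ = 1`. -/
theorem rot_across (k : ℕ) (j : Fin 3) : rot (across k) j = QuotientGroup.mk (gen j) := by
  have h : gen 0 * gen 1 * gen 2 = 1 := by
    refine Subtype.ext (PresentedGroup.one_of_mem (rels := relators) ?_)
    exact ⟨0, rfl⟩
  have h1 : (gen 0)⁻¹ * (gen 2)⁻¹ = gen 1 := by
    rw [mul_assoc, mul_eq_one_iff_inv_eq] at h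
    rw [h, mul_inv_cancel_right]
  have e0 : y0 k = QuotientGroup.mk (gen 0) := rfl
  have e3 : y3 k = QuotientGroup.mk (gen 2) := rfl
  fin_cases j
  · simp [rot, across, e0]
  · have := congrArg (QuotientGroup.mk : G → Gk k) h1
    rw [QuotientGroup.mk_mul, QuotientGroup.mk_inv, QuotientGroup.mk_inv] at this
    simpa [rot, across, e0, e3] using this
  · simp [rot, across, e3]

theorem closure_rot (k : ℕ) : Subgroup.closure (Set.range (rot (across k))) = ⊤ := by
  have hG : Subgroup.closure (Set.range gen) = ⊤ := by
    refine Eq.trans (congrArg _ ?_) (Subgroup.closure_closure_coe_preimage (k := {x 0, x 1, x 3}))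
    ext g
    constructor
    · rintro ⟨j, rfl⟩
      change x (idx j) ∈ ({x 0, x 1, x 3} : Set Gtilde)
      fin_cases j <;> simp [idx]
    · rintro (h | h | h)
      · exact ⟨0, Subtype.ext h.symm⟩
      · exact ⟨1, Subtype.ext h.symm⟩
      · exact ⟨2, Subtype.ext h.symm⟩
  have : Set.range (rot (across k)) = QuotientGroup.mk' (level k) '' Set.range gen := by
    rw [← Set.range_comp]
    exact congrArg Set.range (funext (rot_across k))
  rw [this, ← MonoidHom.map_closure, hG, ← MonoidHom.range_eq_map,
    MonoidHom.range_eq_top.2 (QuotientGroup.mk'_surjective _)]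

theorem rot_pow_two_pow_eq_one_iff (k : ℕ) (j : Fin 3) (n : ℕ) :
    rot (across k) j ^ 2 ^ n = 1 ↔ k < 2 ^ n := by
  rw [rot_across, ← QuotientGroup.mk_pow, QuotientGroup.eq_one_iff]
  change rhoG (gen j ^ 2 ^ n) ∈ utLevel k ↔ _
  rw [map_pow, rhoG_gen, X_pow_mem_utLevel, X0_pow_two_pow_mem_utLevel]

theorem rot_pow_two_pow_ne (k : ℕ) {i j : Fin 3} (hij : i ≠ j) {n : ℕ} (hn : 2 ^ n ≤ k) :
    rot (across k) i ^ 2 ^ n ≠ rot (across k) j ^ 2 ^ n := by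
  have key : ∀ {i j : Fin 3}, i < j → rot (across k) i ^ 2 ^ n ≠ rot (across k) j ^ 2 ^ n := by
    intro i j hij
    rw [rot_across, rot_across, ← QuotientGroup.mk_pow, ← QuotientGroup.mk_pow, Ne, mk_eq_mk_iff,
      map_pow, map_pow, rhoG_gen, rhoG_gen]
    have : (idx i).val < (idx j).val ∧ (idx j).val ≤ (idx i).val + 3 := by
      revert i j
      decide
    exact X_pow_two_pow_not_congr this.1 this.2 hn
  rcases lt_or_gt_of_ne hij with h | h
  · exact key h
  · exact (key h).symm

theorem orderOf_rot {k : ℕ} (hk : k ≠ 0) (j : Fin 3) :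
    orderOf (rot (across k) j) = 2 ^ (Nat.log 2 k + 1) := by
  refine orderOf_eq_prime_pow ?_ ?_
  · rw [rot_pow_two_pow_eq_one_iff, not_lt]
    exact Nat.pow_log_le_self 2 hk
  · rw [rot_pow_two_pow_eq_one_iff]
    exact Nat.lt_pow_succ_log_self one_lt_two k

/-- A cyclic `2`-group has only one involution. -/
theorem eq_pow_of_sq_eq_one {H : Type} [Group H] [Finite H] {r w : H} {s : ℕ}
    (hr : orderOf r = 2 ^ (s + 1)) (hw : w ∈ Subgroup.zpowers r) (h2 : w ^ 2 = 1) (h1 : w ≠ 1) :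
    w = r ^ 2 ^ s := by
  obtain ⟨c, rfl⟩ := (mem_powers_iff_mem_zpowers.2 hw)
  change r ^ c = _
  change (r ^ c) ^ 2 = 1 at h2
  change r ^ c ≠ 1 at h1
  rw [← pow_mul, ← orderOf_dvd_iff_pow_eq_one, hr, pow_succ] at h2
  obtain ⟨d, rfl⟩ := Nat.dvd_of_mul_dvd_mul_right two_pos h2
  rcases Nat.even_or_odd' d with ⟨e, rfl | rfl⟩
  · refine absurd ?_ h1
    rw [← orderOf_dvd_iff_pow_eq_one, hr]
    exact ⟨e, by ring⟩
  · rw [show 2 ^ s * (2 * e + 1) = 2 ^ (s + 1) * e + 2 ^ s by ring, pow_add, pow_mul, ← hr,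
      pow_orderOf_eq_one, one_pow, one_mul]

/-- The involutions of the three cyclic groups are different, so these groups meet trivially. -/
theorem eq_one_of_mem_zpowers_rot {k : ℕ} (hk : k ≠ 0) (i j : Fin 3) (hij : i ≠ j) (z : Gk k)
    (hi : z ∈ Subgroup.zpowers (rot (across k) i)) (hj : z ∈ Subgroup.zpowers (rot (across k) j)) :
    z = 1 := by
  by_contra hz
  obtain ⟨m, hm⟩ := IsPGroup.iff_orderOf.1 (isPGroup_Gk k) z
  obtain ⟨l, rfl⟩ : ∃ l, m = l + 1 := Nat.exists_eq_succ_of_ne_zero fun h => hz <| by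
    rwa [h, pow_zero, orderOf_eq_one_iff] at hm
  have h2 : (z ^ 2 ^ l) ^ 2 = 1 := by
    rw [← pow_mul, ← pow_succ, ← hm, pow_orderOf_eq_one]
  have h1 : z ^ 2 ^ l ≠ 1 := by
    intro h
    have := orderOf_dvd_of_pow_eq_one h
    rw [hm, Nat.pow_dvd_pow_iff_le_right'] at this
    omega
  refine rot_pow_two_pow_ne k hij (Nat.pow_log_le_self 2 hk) ?_
  rw [← eq_pow_of_sq_eq_one (orderOf_rot hk i) (pow_mem hi _) h2 h1,
    ← eq_pow_of_sq_eq_one (orderOf_rot hk j) (pow_mem hj _) h2 h1]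

theorem rot_ne_one {k : ℕ} (hk : k ≠ 0) (j : Fin 3) : rot (across k) j ≠ 1 := by
  intro h
  have := orderOf_rot hk j
  rw [h, orderOf_one, pow_succ] at this
  omega

/-! ### The genus -/

/-- With `N = |G_k|` and `M` the order of the generators, the triangulation has `3 * q` vertices,
where `N = q * M`, as well as `3 * N` edges and `2 * N` triangles. -/
theorem exists_genus {k : ℕ} (hk : 2 ≤ k) : ∃ g q M : ℕ, HasGenus (Surface k) g ∧
    (dualEdges k).ncard = 3 * (q * M) ∧ 2 * g + 3 * q = q * M + 2 ∧ 0 < q ∧ k < M := by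
  have hk0 : k ≠ 0 := by omega
  have : Fintype (Gk k) := Fintype.ofFinite _
  have (j : Fin 3) : Fintype (Gk k ⧸ Subgroup.zpowers (rot (across k) j)) := Fintype.ofFinite _
  classical
  let L := cosetLabelling (across k) (eq_one_of_mem_zpowers_rot hk0) (rot_ne_one hk0)
    (closure_rot k)
  obtain ⟨M, hM⟩ : ∃ M, M = 2 ^ (Nat.log 2 k + 1) := ⟨_, rfl⟩
  have hkM : k < M := hM ▸ Nat.lt_pow_succ_log_self one_lt_two k
  have hcard : ∀ j, Fintype.card (Gk k) =
      Fintype.card (Gk k ⧸ Subgroup.zpowers (rot (across k) j)) * M := fun j => by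
    have := Subgroup.card_eq_card_quotient_mul_card_subgroup (Subgroup.zpowers (rot (across k) j))
    rwa [Nat.card_zpowers, orderOf_rot hk0, ← hM, Nat.card_eq_fintype_card,
      Nat.card_eq_fintype_card] at this
  obtain ⟨q, hq⟩ : ∃ q, q = Fintype.card (Gk k ⧸ Subgroup.zpowers (rot (across k) 0)) := ⟨_, rfl⟩
  have hN : Fintype.card (Gk k) = q * M := hq ▸ hcard 0
  have hq0 : 0 < q := hq ▸ Fintype.card_pos
  have hV : Fintype.card (Σ j : Fin 3, Gk k ⧸ Subgroup.zpowers (rot (across k) j)) = 3 * q := by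
    rw [Fintype.card_sigma, Finset.sum_congr rfl fun j _ => show _ = q from
      Nat.eq_of_mul_eq_mul_right (by omega) ((hcard j).symm.trans hN)]
    simp
  -- `q` is a power of two, and not `1` because `G_k` is not cyclic
  have hq2 : 2 ∣ q := by
    obtain ⟨e, he⟩ := IsPGroup.iff_card.1 (isPGroup_Gk k)
    rw [Nat.card_eq_fintype_card, hN] at he
    obtain ⟨f, -, hf⟩ := (Nat.dvd_prime_pow Nat.prime_two).1 (Dvd.intro M he)
    rcases f with _ | f
    · exfalso
      rw [pow_zero] at hf
      have htop : Subgroup.zpowers (rot (across k) 0) = ⊤ := by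
        rw [← Subgroup.card_eq_iff_eq_top, Nat.card_zpowers, orderOf_rot hk0, ← hM,
          Nat.card_eq_fintype_card, hN, hf, one_mul]
      exact rot_ne_one hk0 1 (eq_one_of_mem_zpowers_rot hk0 0 1 (by decide) _
        (htop ▸ Subgroup.mem_top _) (Subgroup.mem_zpowers _))
    · exact ⟨2 ^ f, by rw [hf, pow_succ, mul_comm]⟩
  obtain ⟨c, rfl⟩ := hq2
  obtain ⟨m, rfl⟩ : ∃ m, M = m + 3 := Nat.exists_eq_add_of_le' (by omega)
  refine ⟨1 + c * m, 2 * c, m + 3, L.hasGenus ?_, ?_, by ring, hq0, hkM⟩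
  · rw [hV, hN]
    push_cast
    ring
  · rw [L.ncard_dualEdges, hN]

end ExpanderSurface

theorem proposition1p5 :
    ∃ g : ℕ → ℕ,
      (∀ k : ℕ, 2 ≤ k → ExpanderSurface.HasGenus (ExpanderSurface.Surface k) (g k)) ∧
      Filter.Tendsto
        (fun k : ℕ => 6 * (g k : ℝ) / ((ExpanderSurface.dualEdges k).ncard : ℝ))
        Filter.atTop (nhds 1) := by
  have h : ∀ k : ℕ, ∃ g : ℕ, 2 ≤ k → ExpanderSurface.HasGenus (ExpanderSurface.Surface k) g ∧
      ∃ q M : ℕ, (ExpanderSurface.dualEdges k).ncard = 3 * (q * M) ∧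
        2 * g + 3 * q = q * M + 2 ∧ 0 < q ∧ k < M := by
    intro k
    by_cases hk : 2 ≤ k
    · obtain ⟨g, q, M, h1, h2⟩ := ExpanderSurface.exists_genus hk
      exact ⟨g, fun _ => ⟨h1, q, M, h2⟩⟩
    · exact ⟨0, fun h => absurd h hk⟩
  choose g hg using h
  refine ⟨g, fun k hk => (hg k hk).1, ?_⟩
  -- the ratio is `1 + 2 / (q * M) - 3 / M`
  have lim : ∀ c : ℝ, Filter.Tendsto (fun k : ℕ => 1 + c / (k : ℝ)) Filter.atTop (nhds 1) := by
    intro c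
    simpa using (tendsto_const_div_atTop_nhds_zero_nat c).const_add 1
  refine tendsto_of_tendsto_of_tendsto_of_le_of_le' (lim (-3)) (lim 2) ?_ ?_ <;>
    filter_upwards [Filter.eventually_ge_atTop 2] with k hk <;>
    obtain ⟨-, q, M, hE, hgq, hq, hM⟩ := hg k hk
  all_goals
    have hq1 : (1 : ℝ) ≤ q := by exact_mod_cast hq
    have hk0 : (0 : ℝ) < k := by exact_mod_cast (by omega : 0 < k)
    have hkM : (k : ℝ) ≤ M := by exact_mod_cast hM.le
    have hM0 : (0 : ℝ) < M := hk0.trans_le hkM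
    have hgr : 2 * (g k : ℝ) + 3 * q = q * M + 2 := by exact_mod_cast hgq
    have e : 6 * (g k : ℝ) / ((ExpanderSurface.dualEdges k).ncard : ℝ) =
        1 + 2 / (q * M) - 3 / M := by
      rw [hE]
      push_cast
      have hq0 : (q : ℝ) ≠ 0 := by positivity
      field_simp
      linarith
    rw [e]
  · have h1 : 3 / (M : ℝ) ≤ 3 / k := by gcongr
    have h2 : (0 : ℝ) ≤ 2 / (q * M) := by positivity
    rw [neg_div]
    linarith
  · have h1 : 2 / ((q : ℝ) * M) ≤ 2 / k := by
      gcongr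
      nlinarith
    have h2 : (0 : ℝ) ≤ 3 / M := by positivity
    linarith
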